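/- Conventions. Let $M$ be a smooth manifold of real dimension $4n$. A triple $(g,I,J)$ is a generalized Kähler (GK) structure on $M$ if $I$ and $J$ are integrable complex structures, $g$ is a Riemannian metric compatible with both $I$ and $J$, and, with $\omega_I=g(I\cdot,\cdot)$, $\omega_J=g(J\cdot,\cdot)$ and $d^c_I\omega_I=-(d\omega_I)(I\cdot,I\cdot,I\cdot)$ (similarly for $J$), $$d^c_I\omega_I = H = -d^c_J\omega_J,\qquad dH=0 .$$ It is nondegenerate if the bivector $\sigma=[I,J]g^{-1}$ defines a nondegenerate pairing on each fibre of $T^*M$; its associated symplectic form is then $\Omega=\sigma^{-1}$, i.e. $\Omega(v,w)=g([I,J]^{-1}v,w)$. For a complex structure $J'$ put $\Omega_{J'}=\Omega+\sqrt{-1}\,J'\Omega$, where $(J'\Omega)(v,w)=-\Omega(J'v,w)$. For a real $2$-form $\eta$, its $(1,1)$-part with respect to $I$ is $\eta^{1,1}_I(v,w)=\tfrac12(\eta(v,w)+\eta(Iv,Iw))$, and it is positive definite if $\eta^{1,1}_I(v,Iv)>0$ for every nonzero tangent vector $v$. Proposition. Let $(M^{4n},g,I,J)$ be a nondegenerate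 generalized Kähler manifold with associated symplectic form $\Omega$. Let $f_t$ be a smooth time-dependent function on $M$, for $t$ in an open interval $S$ containing $0$, and let $X_{f_t}$ be its $\Omega$-Hamiltonian vector field, $df_t=-X_{f_t}\lrcorner\,\Omega$. Let $(\phi_t)_{t\in S}$ be a smooth one-parameter family of diffeomorphisms of $M$ generated by it, i.e. $\phi_0=\mathrm{id}$ and $\frac{d}{dt}\phi_t=X_{f_t}\circ\phi_t$, and let $\phi_t^*J=(d\phi_t)^{-1}\circ J\circ d\phi_t$. Then for every $t\in S$ such that the $(1,1)$-part with respect to $I$ of $-\mathrm{Im}(\Omega_{\phi_t^*J})$ is positive definite at every point, there is a unique Riemannian metric $g'$ on $M$ such that $(g',I,\phi_t^*J)$ is a nondegenerate generalized Kähler structure whose associated symplectic form is $\Omega$. -/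

import Mathlib

open scoped Manifold ContDiff

noncomputable section

namespace GenKahler

section

variable {m : ℕ} {M : Type*} [TopologicalSpace M] [ChartedSpace (EuclideanSpace ℝ (Fin m)) M]
  [IsManifold (𝓡 m) ∞ M]

/-- Fields of endomorphisms of the tangent bundle (no regularity imposed). -/
abbrev EndField (m : ℕ) (M : Type*) [TopologicalSpace M]
    [ChartedSpace (EuclideanSpace ℝ (Fin m)) M] : Type _ :=
  ∀ x : M, TangentSpace (𝓡 m) x →L[ℝ] TangentSpace (𝓡 m) x

/-- Fields of bilinear forms on the tangent bundle (no regularity imposed). -/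
abbrev BilinField (m : ℕ) (M : Type*) [TopologicalSpace M]
    [ChartedSpace (EuclideanSpace ℝ (Fin m)) M] : Type _ :=
  ∀ x : M, TangentSpace (𝓡 m) x →L[ℝ] TangentSpace (𝓡 m) x →L[ℝ] ℝ

/-- Differential forms of degree `k` (no regularity imposed). -/
abbrev FormField (m : ℕ) (M : Type*) [TopologicalSpace M]
    [ChartedSpace (EuclideanSpace ℝ (Fin m)) M] (k : ℕ) : Type _ :=
  ∀ x : M, TangentSpace (𝓡 m) x [⋀^Fin k]→L[ℝ] ℝ

/-- Smooth Riemannian metrics on `M`. -/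
abbrev Metric (m : ℕ) (M : Type*) [TopologicalSpace M]
    [ChartedSpace (EuclideanSpace ℝ (Fin m)) M] [IsManifold (𝓡 m) ∞ M] : Type _ :=
  Bundle.ContMDiffRiemannianMetric (𝓡 m) ∞ (EuclideanSpace ℝ (Fin m))
    (fun x : M => TangentSpace (𝓡 m) x)

/-- The field of endomorphisms `J` is a smooth section of `End(TM)`. -/
def IsSmoothEnd (J : EndField m M) : Prop :=
  ContMDiff (𝓡 m)
    ((𝓡 m).prod 𝓘(ℝ, EuclideanSpace ℝ (Fin m) →L[ℝ] EuclideanSpace ℝ (Fin m))) ∞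
    (fun x => Bundle.TotalSpace.mk' (EuclideanSpace ℝ (Fin m) →L[ℝ] EuclideanSpace ℝ (Fin m))
      (E := fun x : M => TangentSpace (𝓡 m) x →L[ℝ] TangentSpace (𝓡 m) x) x (J x))

/-- The vector field `X` is smooth near the point `x`. -/
def SmoothFieldAt (X : ∀ y : M, TangentSpace (𝓡 m) y) (x : M) : Prop :=
  ContMDiffAt (𝓡 m) (𝓡 m).tangent ∞ (fun y => (⟨y, X y⟩ : TangentBundle (𝓡 m) M)) x

/-- The Nijenhuis expression `[JX, JY] - J[JX, Y] - J[X, JY] - [X, Y]` at the point `x`. -/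
def nijenhuis (J : EndField m M) (X Y : ∀ y : M, TangentSpace (𝓡 m) y) (x : M) :
    TangentSpace (𝓡 m) x :=
  VectorField.mlieBracket (𝓡 m) (fun y => J y (X y)) (fun y => J y (Y y)) x
    - J x (VectorField.mlieBracket (𝓡 m) (fun y => J y (X y)) Y x)
    - J x (VectorField.mlieBracket (𝓡 m) X (fun y => J y (Y y)) x)
    - VectorField.mlieBracket (𝓡 m) X Y x

/-- `J` is an integrable complex structure on `M`: a smooth field of endomorphisms with
`J² = -1` and vanishing Nijenhuis tensor. -/
structure IsComplexStructure (J : EndField m M) : Prop where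
  smooth : IsSmoothEnd J
  sq : ∀ (x : M) (v : TangentSpace (𝓡 m) x), J x (J x v) = -v
  integrable : ∀ (x : M) (X Y : ∀ y : M, TangentSpace (𝓡 m) y),
    SmoothFieldAt X x → SmoothFieldAt Y x → nijenhuis J X Y x = 0

/-- The exterior derivative of a differential form on `M`, computed at each point in the
preferred chart there. -/
def extDer {k : ℕ} (η : FormField m M k) : FormField m M (k + 1) := fun x =>
  (extDeriv (fun u : EuclideanSpace ℝ (Fin m) =>
      (η ((extChartAt (𝓡 m) x).symm u)).compContinuousLinearMap
        (mfderiv 𝓘(ℝ, EuclideanSpace ℝ (Fin m)) (𝓡 m) (extChartAt (𝓡 m) x).symm u))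
    (extChartAt (𝓡 m) x x)).compContinuousLinearMap
      (mfderiv (𝓡 m) 𝓘(ℝ, EuclideanSpace ℝ (Fin m)) (extChartAt (𝓡 m) x) x)

/-- `g` is compatible with (Hermitian for) the almost complex structure `J`. -/
structure IsHermitian (g : Metric m M) (J : EndField m M) : Prop where
  sq : ∀ (x : M) (v : TangentSpace (𝓡 m) x), J x (J x v) = -v
  compat : ∀ (x : M) (v w : TangentSpace (𝓡 m) x), g.inner x (J x v) (J x w) = g.inner x v w

theorem IsHermitian.self_eq_zero {g : Metric m M} {J : EndField m M} (h : IsHermitian g J)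
    (x : M) (v : TangentSpace (𝓡 m) x) : g.inner x (J x v) v = 0 := by
  have h1 := h.compat x (J x v) v
  rw [h.sq, map_neg, neg_apply, g.symm x v (J x v)] at h1
  linarith

/-- The `2`-form `(v, w) ↦ B v w` defined by an alternating bilinear form on a tangent space. -/
def toTwoForm {x : M}
    (B : TangentSpace (𝓡 m) x →L[ℝ] TangentSpace (𝓡 m) x →L[ℝ] ℝ) (hB : ∀ v, B v v = 0) :
    TangentSpace (𝓡 m) x [⋀^Fin 2]→L[ℝ] ℝ where
  toFun v := B (v 0) (v 1)
  map_update_add' v i a b := by fin_cases i <;> simp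
  map_update_smul' v i c a := by fin_cases i <;> simp
  cont := by
    have h : Continuous fun p : EuclideanSpace ℝ (Fin m) × EuclideanSpace ℝ (Fin m) =>
        (show EuclideanSpace ℝ (Fin m) →L[ℝ] EuclideanSpace ℝ (Fin m) →L[ℝ] ℝ from B) p.1 p.2 :=
      ContinuousLinearMap.continuous₂ _
    have h' : Continuous fun v : Fin 2 → EuclideanSpace ℝ (Fin m) => (v 0, v 1) := by fun_prop
    exact h.comp h'
  map_eq_zero_of_eq' v i j hv hij := by
    fin_cases i <;> fin_cases j <;> simp_all

/-- The fundamental form `ω_J(v, w) = g(J v, w)` of the Hermitian structure `(g, J)`. -/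
def fundamentalForm (g : Metric m M) (J : EndField m M) (h : IsHermitian g J) :
    FormField m M 2 := fun x => toTwoForm ((g.inner x) ∘L (J x)) (h.self_eq_zero x)

/-- The operator `d^c_J = J d` on forms, with `(J η)(X, Y, Z) = - η(J X, J Y, J Z)` for
the `3`-form `η`; here applied to `2`-forms. -/
def dc (J : EndField m M) (η : FormField m M 2) : FormField m M 3 := fun x =>
  -((extDer η x).compContinuousLinearMap (J x))

/-- `(g, I, J)` is a generalized Kähler structure: `I`, `J` are integrable complex structures,
`g` is compatible with both, and `d^c_I ω_I = H = - d^c_J ω_J` with `dH = 0`. -/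
structure IsGK (g : Metric m M) (I J : EndField m M) : Prop where
  complex_I : IsComplexStructure I
  complex_J : IsComplexStructure J
  hermitian_I : IsHermitian g I
  hermitian_J : IsHermitian g J
  dc_eq : dc I (fundamentalForm g I hermitian_I) = -dc J (fundamentalForm g J hermitian_J)
  closed : extDer (dc I (fundamentalForm g I hermitian_I)) = 0

/-- The bivector `σ = [I, J] g⁻¹`, as a map `T*M → TM`; the pairing of two covectors is
`σ(α, β) = β (σ α)`. -/
def sigma (g : Metric m M) (I J : EndField m M) (x : M) :
    (TangentSpace (𝓡 m) x →L[ℝ] ℝ) →L[ℝ] TangentSpace (𝓡 m) x :=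
  ((I x) ∘L (J x) - (J x) ∘L (I x)) ∘L (g.inner x).inverse

/-- `(g, I, J)` is a nondegenerate generalized Kähler structure: `σ` is a nondegenerate pairing
on each fibre of `T*M`. -/
structure IsNondegGK (g : Metric m M) (I J : EndField m M) : Prop extends IsGK g I J where
  nondeg : ∀ (x : M) (α : TangentSpace (𝓡 m) x →L[ℝ] ℝ),
    (∀ β : TangentSpace (𝓡 m) x →L[ℝ] ℝ, β (sigma g I J x α) = 0) → α = 0

/-- The form `Ω = σ⁻¹ : TM → T*M`, that is `Ω(v, w) = g([I, J]⁻¹ v, w)`. -/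
def Omega (g : Metric m M) (I J : EndField m M) : BilinField m M := fun x =>
  (sigma g I J x).inverse

/-- The complex valued form `Ω_J = Ω + √-1 JΩ`, where `(JΩ)(v, w) = -Ω(J v, w)`. When `Ω` is of
type `(2,0) + (0,2)` for `J`, it is the unique `(2,0)`-form for `J` with real part `Ω`. -/
def complexForm (Ω : BilinField m M) (J : EndField m M) (x : M)
    (v w : TangentSpace (𝓡 m) x) : ℂ :=
  (Ω x v w : ℂ) + Complex.I * ((-(Ω x (J x v) w) : ℝ) : ℂ)

/-- The `(1,1)`-part with respect to `I` of a real bilinear form `η` on a tangent space. -/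
def oneOnePart (I : EndField m M) (x : M)
    (η : TangentSpace (𝓡 m) x → TangentSpace (𝓡 m) x → ℝ)
    (v w : TangentSpace (𝓡 m) x) : ℝ :=
  (η v w + η (I x v) (I x w)) / 2

/-- Positive definiteness of a real `(1,1)`-form `η` for `I` at `x`: `η(v, I v) > 0` for
`v ≠ 0`. -/
def IsPositive (I : EndField m M) (x : M)
    (η : TangentSpace (𝓡 m) x → TangentSpace (𝓡 m) x → ℝ) : Prop :=
  ∀ v : TangentSpace (𝓡 m) x, v ≠ 0 → 0 < η v (I x v)

/-- `X` is the `Ω`-Hamiltonian vector field of `f`: `df = - X ⌟ Ω`. -/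
def IsHamiltonianField (Ω : BilinField m M) (f : M → ℝ)
    (X : ∀ x : M, TangentSpace (𝓡 m) x) : Prop :=
  ∀ (x : M) (w : TangentSpace (𝓡 m) x),
    (mfderiv (𝓡 m) 𝓘(ℝ, ℝ) f x w : ℝ) = -(Ω x (X x) w)

/-- `φ` is the smooth family of diffeomorphisms, defined for `t` in the open interval `S`
around `0`, which starts at the identity and is generated by the time-dependent `Ω`-Hamiltonian
vector field of the smooth time-dependent function `f`. -/
structure IsHamiltonianFlow (Ω : BilinField m M) (S : Set ℝ) (f : ℝ → M → ℝ)
    (φ : ℝ → M ≃ₘ^∞⟮𝓡 m, 𝓡 m⟯ M) : Prop where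
  isOpen : IsOpen S
  ordConnected : S.OrdConnected
  zero_mem : (0 : ℝ) ∈ S
  smooth_f : ContMDiffOn (𝓘(ℝ, ℝ).prod (𝓡 m)) 𝓘(ℝ, ℝ) ∞
    (fun p : ℝ × M => f p.1 p.2) (S ×ˢ Set.univ)
  smooth_flow : ContMDiffOn (𝓘(ℝ, ℝ).prod (𝓡 m)) (𝓡 m) ∞
    (fun p : ℝ × M => φ p.1 p.2) (S ×ˢ Set.univ)
  start : ∀ x : M, φ 0 x = x
  generated : ∃ X : ℝ → ∀ x : M, TangentSpace (𝓡 m) x,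
    (∀ t ∈ S, IsHamiltonianField Ω (f t) (X t)) ∧
    ∀ t ∈ S, ∀ x : M, HasMFDerivAt 𝓘(ℝ, ℝ) (𝓡 m) (fun s : ℝ => φ s x) t
      ((1 : ℝ →L[ℝ] ℝ).smulRight (X t (φ t x)))

/-- The pullback `φ^*J = (dφ)⁻¹ ∘ J ∘ dφ` of a field of endomorphisms by a diffeomorphism. -/
def pullbackEnd (φ : M ≃ₘ^∞⟮𝓡 m, 𝓡 m⟯ M) (J : EndField m M) : EndField m M := fun x =>
  (mfderiv (𝓡 m) (𝓡 m) φ x).inverse ∘L (J (φ x)) ∘L (mfderiv (𝓡 m) (𝓡 m) φ x)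

end

end GenKahler

end

/-!
A nondegenerate generalized Kähler structure is determined by the two complex structures `I`, `J`
and the symplectic form `Ω`: since `Ω = g ∘ [I, J]⁻¹`, the metric is `g(v, w) = Ω([I, J] v, w)`.
This gives uniqueness at once. Conversely (`existsUnique_metric`), let `Ω` be a symplectic form
with `Ω(I v, w) = Ω(v, I w)` and `Ω(J v, w) = Ω(v, J w)` for integrable `I`, `J`, and suppose that
`g(v, w) := Ω([I, J] v, w)` is positive. Because `[I, J]` anticommutes with `I` and `J`, the form
`g` is symmetric and Hermitian for both. Put `η = Ω(J ·, ·)`; then `ω_I = η + η(I ·, I ·)`, and `η`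
is closed because `Ω` is closed of type `(2, 0) + (0, 2)` for `J` (`cyclicDeriv_twist_eq_zero`).
For a closed two-form `η` and an integrable `I` one has
`d (η + η(I ·, I ·)) (I ·, I ·, I ·) = - d (η(I ·, ·) + η(·, I ·))` (`cyclicDeriv_oneOne`), so that
`d^c_I ω_I = dβ` with `β(v, w) = Ω((I J + J I) v, w)`. Exchanging `I` and `J` changes the sign of
`[I, J]` and fixes `β`, whence `- d^c_J ω_J = dβ` as well; and `dβ` is closed.

It remains to see that `Ω` has these properties with respect to `I` and `φ_t^* J`. That `Ω` is
closed (`IsNondegGK.cyclicDeriv_Omega`) is the one place where the equation `d^c_I ω_I = -d^c_J ω_J`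
of the given structure enters: by integrability, `∇J` is determined by `H_J = d^c_J ω_J` through
Bismut's formula `2 g((∇_x J) y, z) = H_J(x, J y, z) + H_J(x, y, J z)`, and likewise for `I`
(`covDeriv_eq_torsion`). As `H_I = H = -H_J`, substitution in `dΩ` leaves a combination of values
of `H`, which vanishes because `H` has type `(2, 1) + (1, 2)` for both `I` and `J`
(`cyclicSum_poisson_eq_zero`).

Since `Ω` is closed, the Hamiltonian flow preserves it (`IsHamiltonianFlow.pullback_eq`), so
`Ω(J' v, w) = Ω(v, J' w)` passes from `J' = J` to `J' = φ_t^* J`. Finally the positivity hypothesis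
on the `(1, 1)`-part of `- Im Ω_{J'}` is, up to a factor `2`, positivity of `Ω([I, J'] v, v)`.

All identities between exterior derivatives are checked at one point of one chart, where a two-form
is a map `B : V → V →L[ℝ] V →L[ℝ] ℝ` and `dB` is the cyclic sum `cyclicDeriv B`.
-/

noncomputable section

open scoped Topology

namespace GenKahler

/-! ### The first jet of a Hermitian structure at a point -/

/-- Here `a x y z` stands for `g((∇_x J) y, z)` and `hN` for the vanishing of the Nijenhuis tensor
of `J`; the form `H` is then `d^c ω`. The first identity says that `J` is parallel for the Bismut
connection `∇ - g⁻¹H / 2`, the second that `H` has type `(2, 1) + (1, 2)`. -/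
theorem bismut_of_nijenhuis {V : Type*} [AddCommGroup V] {J : V → V}
    {a : V → V → V → ℝ}
    (hJ : ∀ x, J (J x) = -x) (hskew : ∀ x y z, a x y z = -a x z y)
    (ha : ∀ x y z, a x (J y) z = a x y (J z))
    (hn1 : ∀ x y z, a (-x) y z = -a x y z) (hn3 : ∀ x y z, a x y (-z) = -a x y z)
    (hN : ∀ x y z, a (J x) y z - a (J y) x z - a y x (J z) + a x y (J z) = 0)
    {H : V → V → V → ℝ}
    (hH : ∀ x y z, H x y z = -(a (J x) (J y) (J z) + a (J y) (J z) (J x) + a (J z) (J x) (J y))) :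
    (∀ x y z, 2 * a x y z = H x (J y) z + H x y (J z)) ∧
      ∀ x y z, H x y z = H (J x) (J y) z + H (J x) y (J z) + H x (J y) (J z) := by
  have hn2 : ∀ x y z, a x (-y) z = -a x y z := fun x y z => by
    rw [hskew, hn3, hskew x z y, neg_neg]
  refine ⟨fun x y z => ?_, fun x y z => ?_⟩
  all_goals
    simp only [hH, hJ, hn1, hn2, hn3, ha, neg_neg]
    have m1 := hN (J x) y z
    have m2 := hN (J y) z x
    have m3 := hN (J z) x y
    have k1 := hN (J y) x z
    have k2 := hN (J z) y x
    have k3 := hN (J x) z y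
    simp only [hJ, hn1, hn3, ha] at m1 m2 m3 k1 k2 k3
    linarith [hskew x y z, hskew y z x, hskew z x y, hskew (J x) y (J z), hskew (J y) z (J x),
      hN x y z, hN y z x, hN z x y, hN y x z, hN z y x, hN x z y, hskew (J x) y z, hskew (J y) z x,
      hskew (J z) x y, ha x z y, ha y x z, ha z y x, hskew x y (J z), hskew y z (J x),
      hskew z x (J y), hskew (J z) x (J y), ha (J x) z y, ha (J y) x z, ha (J z) y x]

/-- The linear combination of values of the torsion `H` to which the exterior derivative of `Ω`
reduces. It vanishes for every three-form of type `(2, 1) + (1, 2)` for both `I` and `J`. -/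
theorem cyclicSum_poisson_eq_zero {V : Type*} [AddCommGroup V] {I J : V → V}
    {H : V → V → V → ℝ}
    (hsub : ∀ x x' y z, H (x - x') y z = H x y z - H x' y z)
    (hadd : ∀ x x' y z, H (x + x') y z = H x y z + H x' y z)
    (hcyc : ∀ x y z, H x y z = H y z x)
    (hI : ∀ x y z, H x y z = H (I x) (I y) z + H (I x) y (I z) + H x (I y) (I z))
    (hJ : ∀ x y z, H x y z = H (J x) (J y) z + H (J x) y (J z) + H x (J y) (J z))
    {K : V → V → V → ℝ}
    (hK : ∀ x y z, K x y z = 2 * H (I (J x) - J (I x)) (J y) (I z)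
      + 2 * H (I (J x) - J (I x)) (I y) (J z) + H (I (J x) - J (I x)) (I (J y) + J (I y)) z
      + H (I (J x) - J (I x)) y (I (J z) + J (I z))) (x y z : V) :
    K x y z + K y z x + K z x y = 0 := by
  have hadd2 : ∀ x y y' z, H x (y + y') z = H x y z + H x y' z := fun x y y' z => by
    rw [hcyc, hadd, hcyc x y, hcyc x y']
  have hadd3 : ∀ x y z z', H x y (z + z') = H x y z + H x y z' := fun x y z z' => by
    rw [hcyc, hadd2, hcyc x y, hcyc x y]
  have c : ∀ x y z, H z x y = H x y z := fun x y z => hcyc z x y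
  have d : ∀ x y z, H y z x = H x y z := fun x y z => (hcyc x y z).symm
  simp only [hK, hsub, hadd2, hadd3]
  simp only [c _ _ (J (I z)), c _ _ (I (J z)), d _ (I (J y)) _, d _ (J (I y)) _]
  linarith [hI x y z, hJ x y z, hJ x (I y) (I z), hI x (J y) (J z), hJ (I x) y (I z),
    hI (J x) y (J z), hJ (I x) (I y) z, hI (J x) (J y) z]

/-! The letters `DB`, `DJ`, `Dg` denote the derivatives at a point of a bilinear form `B`, an almost
complex structure `J` and a metric `g`, with the direction of differentiation as first argument. The
hypothesis `DJ x (J y) = -J (DJ x y)` is the derivative of `J² = -1`, and the expression set to zero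
in `hN` is the Nijenhuis tensor of `J` on constant vector fields. -/

section FirstJet

variable {V : Type*} [NormedAddCommGroup V] [NormedSpace ℝ V]

/-- If `B` is closed and of type `(2, 0) + (0, 2)` for the integrable `J`, then `B(J ·, ·)` is
closed. -/
theorem cyclicSum_twist_eq_zero {J : V →L[ℝ] V} {B : V →L[ℝ] V →L[ℝ] ℝ} {DJ : V →L[ℝ] V →L[ℝ] V}
    {DB : V →L[ℝ] V →L[ℝ] V →L[ℝ] ℝ}
    (hJ : ∀ x, J (J x) = -x) (hDJ : ∀ x y, DJ x (J y) = -J (DJ x y))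
    (hN : ∀ x y, DJ (J x) y - DJ (J y) x + J (DJ y x) - J (DJ x y) = 0)
    (hB : ∀ x y, B (J x) y = B x (J y))
    (hDBJ : ∀ x y z, DB x (J y) z + B (DJ x y) z = DB x y (J z) + B y (DJ x z))
    (hskew : ∀ x y, B x y = -B y x)
    (hclosed : ∀ x y z, DB x y z + DB y z x + DB z x y = 0) (x y z : V) :
    (DB x (J y) z + B (DJ x y) z) + (DB y (J z) x + B (DJ y z) x)
      + (DB z (J x) y + B (DJ z x) y) = 0 := by
  have c0 := hclosed (J x) (J y) (J z)
  have c1 := hclosed (J x) y z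
  have c2 := hclosed x (J y) z
  have c3 := hclosed x y (J z)
  have n1 := congrArg (B · (J z)) (hN x y)
  have n2 := congrArg (B · (J x)) (hN y z)
  have n3 := congrArg (B · (J y)) (hN z x)
  have t1 := hDBJ (J x) y (J z)
  have t2 := hDBJ (J y) z (J x)
  have t3 := hDBJ (J z) x (J y)
  have t4 := hDBJ x y z
  have t5 := hDBJ y z x
  have t6 := hDBJ z x y
  have swap : ∀ u w, B u (J w) = -B w (J u) := fun u w => by rw [← hB, hskew]
  have s1 := swap y (DJ (J x) z)
  have s2 := swap z (DJ (J y) x)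
  have s3 := swap x (DJ (J z) y)
  simp only [map_sub, map_add, sub_apply, add_apply, map_neg,
    map_zero, zero_apply, hB, hJ, hDJ] at n1 n2 n3 t1 t2 t3
  linarith [hskew y (DJ x z), hskew z (DJ y x), hskew x (DJ z y)]

/-- With `ω = B + B(J ·, J ·)` and `β = B(J ·, ·) + B(·, J ·)` for a closed two-form `B` and an
integrable `J`, one has `dω(J ·, J ·, J ·) = -dβ`. In terms of types, `ω` is `2 B^{1,1}` and `β` is
`2i (B^{2,0} - B^{0,2})`, and `dB = 0` says that `∂B^{1,1} = -∂̄B^{2,0}`. -/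
theorem cyclicSum_oneOne {J : V →L[ℝ] V} {B : V →L[ℝ] V →L[ℝ] ℝ} {DJ : V →L[ℝ] V →L[ℝ] V}
    {DB : V →L[ℝ] V →L[ℝ] V →L[ℝ] ℝ}
    (hJ : ∀ x, J (J x) = -x) (hDJ : ∀ x y, DJ x (J y) = -J (DJ x y))
    (hN : ∀ x y, DJ (J x) y - DJ (J y) x + J (DJ y x) - J (DJ x y) = 0)
    (hskew : ∀ x y, B x y = -B y x)
    (hclosed : ∀ x y z, DB x y z + DB y z x + DB z x y = 0)
    {Dω Dβ : V → V → V → ℝ}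
    (hω : ∀ x y z, Dω x y z =
      DB x y z + (DB x (J y) (J z) + B (DJ x y) (J z) + B (J y) (DJ x z)))
    (hβ : ∀ x y z, Dβ x y z =
      (DB x (J y) z + B (DJ x y) z) + (DB x y (J z) + B y (DJ x z))) (x y z : V) :
    Dω (J x) (J y) (J z) + Dω (J y) (J z) (J x) + Dω (J z) (J x) (J y) =
      -(Dβ x y z + Dβ y z x + Dβ z x y) := by
  have c0 := hclosed (J x) (J y) (J z)
  have c1 := hclosed (J x) y z
  have c2 := hclosed x (J y) z
  have c3 := hclosed x y (J z)
  have n1 := congrArg (fun v => B (J v) z) (hN x y)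
  have n2 := congrArg (fun v => B (J v) x) (hN y z)
  have n3 := congrArg (fun v => B (J v) y) (hN z x)
  simp only [map_sub, map_add, sub_apply, add_apply,
    map_zero, zero_apply, hJ, map_neg, neg_apply] at n1 n2 n3
  simp only [hω, hβ, hJ, hDJ, map_neg, neg_apply, neg_neg]
  linarith [hskew y (DJ x z), hskew z (DJ y x), hskew x (DJ z y),
    hskew y (J (DJ (J x) z)), hskew z (J (DJ (J y) x)), hskew x (J (DJ (J z) y))]

/-- The Christoffel symbol of the first kind `g(∇_x y, z)` of constant vector fields `x`, `y`, `z`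
for the Levi-Civita connection. -/
def christoffel (Dg : V →L[ℝ] V →L[ℝ] V →L[ℝ] ℝ) (x y z : V) : ℝ :=
  (Dg x y z + Dg y x z - Dg z x y) / 2

/-- The covariant derivative `g((∇_x J) y, z)` for the Levi-Civita connection, for `J` skew-adjoint
with respect to `g`. -/
def covDeriv (g : V →L[ℝ] V →L[ℝ] ℝ) (Dg : V →L[ℝ] V →L[ℝ] V →L[ℝ] ℝ)
    (J : V →L[ℝ] V) (DJ : V →L[ℝ] V →L[ℝ] V) (x y z : V) : ℝ :=
  g (DJ x y) z + christoffel Dg x (J y) z + christoffel Dg x y (J z)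

/-- For a Hermitian structure `(g, J)` with `J` integrable and `H = d^c ω`, the Levi-Civita
derivative of `J` is determined by `H`, and `H` has type `(2, 1) + (1, 2)`. -/
theorem covDeriv_eq_torsion {g : V →L[ℝ] V →L[ℝ] ℝ} {Dg : V →L[ℝ] V →L[ℝ] V →L[ℝ] ℝ}
    {J : V →L[ℝ] V} {DJ : V →L[ℝ] V →L[ℝ] V}
    (hg : ∀ y z, g y z = g z y) (hDg : ∀ x y z, Dg x y z = Dg x z y)
    (hgJ : ∀ y z, g (J y) z = -g y (J z))
    (hDgJ : ∀ x y z, Dg x (J y) z + g (DJ x y) z = -(Dg x y (J z) + g y (DJ x z)))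
    (hJ : ∀ x, J (J x) = -x) (hDJ : ∀ x y, DJ x (J y) = -J (DJ x y))
    (hN : ∀ x y, DJ (J x) y - DJ (J y) x + J (DJ y x) - J (DJ x y) = 0)
    {Dω H : V → V → V → ℝ} (hω : ∀ x y z, Dω x y z = Dg x (J y) z + g (DJ x y) z)
    (hH : ∀ x y z, H x y z =
      -(Dω (J x) (J y) (J z) + Dω (J y) (J z) (J x) + Dω (J z) (J x) (J y))) :
    (∀ x y z, 2 * covDeriv g Dg J DJ x y z = H x (J y) z + H x y (J z)) ∧
      ∀ x y z, H x y z = H (J x) (J y) z + H (J x) y (J z) + H x (J y) (J z) := by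
  refine bismut_of_nijenhuis hJ (fun x y z => ?_) (fun x y z => ?_) (fun x y z => ?_)
    (fun x y z => ?_) (fun x y z => ?_) (fun x y z => ?_)
  · simp only [covDeriv, christoffel]
    linarith [hDgJ x y z, hg y (DJ x z), hDg x (J y) z, hDg x y (J z), hDg z x (J y),
      hDg y x (J z), hDg (J y) x z, hDg (J z) x y]
  · simp only [covDeriv, christoffel, hJ, hDJ, map_neg, neg_apply, hgJ]
    linarith
  · simp only [covDeriv, christoffel, map_neg, neg_apply]
    ring
  · simp only [covDeriv, christoffel, map_neg, neg_apply]
    ring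
  · have n := congrArg (g · z) (hN x y)
    simp only [map_sub, map_add, sub_apply, add_apply, map_zero,
      zero_apply, hgJ] at n
    simp only [covDeriv, christoffel, hJ, map_neg, neg_apply]
    linarith [hDg z (J x) (J y), hDg z x y, hDg (J z) (J x) y, hDg (J z) x (J y)]
  · simp only [hH, hω, covDeriv, christoffel, hJ, map_neg, neg_apply]
    linarith [hDg (J z) x (J y), hDg (J y) x (J z), hDg (J x) y (J z), hDg (J z) y (J x),
      hDg (J x) z (J y), hDg (J y) z (J x), hDg x (J y) (J z), hDg y (J x) (J z), hDg z (J x) (J y),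
      hDg x (J z) (J y), hDg y (J z) (J x), hDg z (J y) (J x)]

/-- If `d^c_I ω_I = -d^c_J ω_J` then the form `B` with `B([I, J] y, z) = g(y, z)` is closed. The
derivative of `B` in directions `[I, J] x` is computed by differentiating that relation and
replacing ordinary derivatives by covariant ones: the Christoffel symbols cancel in the cyclic sum,
and what remains is a combination of values of the torsion. -/
theorem cyclicSum_symplectic_eq_zero {g B : V →L[ℝ] V →L[ℝ] ℝ} {Dg DB : V →L[ℝ] V →L[ℝ] V →L[ℝ] ℝ}
    {I J : V →L[ℝ] V} {DI DJ : V →L[ℝ] V →L[ℝ] V}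
    (hg : ∀ y z, g y z = g z y) (hDg : ∀ x y z, Dg x y z = Dg x z y)
    (hgI : ∀ y z, g (I y) z = -g y (I z))
    (hDgI : ∀ x y z, Dg x (I y) z + g (DI x y) z = -(Dg x y (I z) + g y (DI x z)))
    (hI : ∀ x, I (I x) = -x) (hDI : ∀ x y, DI x (I y) = -I (DI x y))
    (hNI : ∀ x y, DI (I x) y - DI (I y) x + I (DI y x) - I (DI x y) = 0)
    (hgJ : ∀ y z, g (J y) z = -g y (J z))
    (hDgJ : ∀ x y z, Dg x (J y) z + g (DJ x y) z = -(Dg x y (J z) + g y (DJ x z)))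
    (hJ : ∀ x, J (J x) = -x) (hDJ : ∀ x y, DJ x (J y) = -J (DJ x y))
    (hNJ : ∀ x y, DJ (J x) y - DJ (J y) x + J (DJ y x) - J (DJ x y) = 0)
    {ωI ωJ : V → V → V → ℝ}
    (hωI : ∀ x y z, ωI x y z = Dg x (I y) z + g (DI x y) z)
    (hωJ : ∀ x y z, ωJ x y z = Dg x (J y) z + g (DJ x y) z)
    (hH : ∀ x y z, ωI (I x) (I y) (I z) + ωI (I y) (I z) (I x) + ωI (I z) (I x) (I y) =
      -(ωJ (J x) (J y) (J z) + ωJ (J y) (J z) (J x) + ωJ (J z) (J x) (J y)))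
    (hB : ∀ y z, B (I (J y) - J (I y)) z = g y z) (hBskew : ∀ y z, B y z = -B z y)
    (hDB : ∀ x y z, DB x (I (J y) - J (I y)) z
      + B (DI x (J y) + I (DJ x y) - (DJ x (I y) + J (DI x y))) z = Dg x y z)
    (hsurj : ∀ x, ∃ y, x = I (J y) - J (I y)) (x y z : V) :
    DB x y z + DB y z x + DB z x y = 0 := by
  set P : V → V := fun y => I (J y) - J (I y) with hP
  set H : V → V → V → ℝ := fun x y z =>
    -(ωI (I x) (I y) (I z) + ωI (I y) (I z) (I x) + ωI (I z) (I x) (I y)) with hHdef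
  obtain ⟨covI, typeI⟩ := covDeriv_eq_torsion (H := H) hg hDg hgI hDgI hI hDI hNI hωI
    fun x y z => rfl
  obtain ⟨covJ, typeJ⟩ := covDeriv_eq_torsion (H := fun x y z => -H x y z) hg hDg hgJ hDgJ hJ hDJ
    hNJ hωJ fun x y z => by rw [hHdef]; linarith [hH x y z]
  -- the derivative of `B(P y, z) = g(y, z)`, with `DI`, `DJ` replaced by covariant derivatives
  have key : ∀ x y z, DB (P x) (P y) (P z) =
      Dg (P x) y (P z) + (covDeriv g Dg I DI (P x) (J y) z + covDeriv g Dg I DI (P x) y (J z)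
        - covDeriv g Dg J DJ (P x) y (I z) - covDeriv g Dg J DJ (P x) (I y) z
        - christoffel Dg (P x) (P y) z - christoffel Dg (P x) y (P z)) := by
    intro x y z
    have h1 := hDB (P x) y (P z)
    rw [hBskew _ (P z), hB z, hg z] at h1
    simp only [map_sub, map_add, sub_apply, add_apply, hgI, hgJ] at h1
    simp only [covDeriv, christoffel]
    simp only [hP, map_sub, sub_apply] at h1 ⊢
    linarith
  have pois := cyclicSum_poisson_eq_zero (I := I) (J := J) (H := H)
    (fun x x' y z => by simp only [hHdef, hωI, map_sub, sub_apply]; ring)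
    (fun x x' y z => by simp only [hHdef, hωI, map_add, add_apply]; ring)
    (fun x y z => by simp only [hHdef]; ring)
    typeI (fun x y z => by linarith [typeJ x y z]) (fun x y z => rfl)
  obtain ⟨x, rfl⟩ := hsurj x
  obtain ⟨y, rfl⟩ := hsurj y
  obtain ⟨z, rfl⟩ := hsurj z
  have p := pois x y z
  have hH2 : ∀ x y y' z, H x (y + y') z = H x y z + H x y' z := fun x y y' z => by
    simp only [hHdef, hωI, map_add, add_apply]; ring
  have hH3 : ∀ x y z z', H x y (z + z') = H x y z + H x y z' := fun x y z z' => by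
    simp only [hHdef, hωI, map_add, add_apply]; ring
  have k1 := key x y z
  have k2 := key y z x
  have k3 := key z x y
  change DB (P x) (P y) (P z) + DB (P y) (P z) (P x) + DB (P z) (P x) (P y) = 0
  -- the Christoffel symbols cancel in the cyclic sum
  have gam : (Dg (P x) y (P z) - christoffel Dg (P x) (P y) z - christoffel Dg (P x) y (P z))
      + (Dg (P y) z (P x) - christoffel Dg (P y) (P z) x - christoffel Dg (P y) z (P x))
      + (Dg (P z) x (P y) - christoffel Dg (P z) (P x) y - christoffel Dg (P z) x (P y)) = 0 := by
    simp only [christoffel]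
    linarith [hDg (P x) y (P z), hDg (P y) z (P x), hDg (P z) x (P y), hDg x (P y) (P z),
      hDg y (P z) (P x), hDg z (P x) (P y), hDg (P x) z (P y), hDg (P y) x (P z), hDg (P z) y (P x)]
  have cc : ∀ x y z, 2 * (covDeriv g Dg I DI (P x) (J y) z + covDeriv g Dg I DI (P x) y (J z)
        - covDeriv g Dg J DJ (P x) y (I z) - covDeriv g Dg J DJ (P x) (I y) z) =
        2 * H (P x) (J y) (I z) + 2 * H (P x) (I y) (J z) + H (P x) (I (J y) + J (I y)) z
          + H (P x) y (I (J z) + J (I z)) := fun x y z => by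
    rw [hH2, hH3]
    linarith [covI (P x) (J y) z, covI (P x) y (J z), covJ (P x) y (I z), covJ (P x) (I y) z]
  linarith [cc x y z, cc y z x, cc z x y]

end FirstJet

/-! ### Two-forms and complex structures on a vector space -/

section Flat

variable {V : Type*} [NormedAddCommGroup V] [NormedSpace ℝ V]

/-- The value `dB(x, y, z)` at `u` of the exterior derivative of a two-form `B` on a vector
space. -/
def cyclicDeriv (B : V → V →L[ℝ] V →L[ℝ] ℝ) (u x y z : V) : ℝ :=
  fderiv ℝ B u x y z + fderiv ℝ B u y z x + fderiv ℝ B u z x y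

/-- The Nijenhuis tensor `[JX, JY] - J[JX, Y] - J[X, JY] - [X, Y]` at `u`, for `J² = -1`, of the
constant vector fields `x`, `y` on a vector space. -/
def flatNijenhuis (J : V → V →L[ℝ] V) (u x y : V) : V :=
  fderiv ℝ J u (J u x) y - fderiv ℝ J u (J u y) x + J u (fderiv ℝ J u y x)
    - J u (fderiv ℝ J u x y)

variable {B : V → V →L[ℝ] V →L[ℝ] ℝ} {J I : V → V →L[ℝ] V} {u : V}

theorem hasFDerivAt_end_apply (hJ : DifferentiableAt ℝ J u) {w : V → V} {w' : V →L[ℝ] V}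
    (hw : HasFDerivAt w w' u) :
    HasFDerivAt (fun v => J v (w v)) ((J u).comp w' + (fderiv ℝ J u).flip (w u)) u :=
  hJ.hasFDerivAt.clm_apply hw

theorem fderiv_end_end_apply (hI : DifferentiableAt ℝ I u) (hJ : DifferentiableAt ℝ J u) (x y : V) :
    fderiv ℝ (fun v => I v (J v y)) u x = fderiv ℝ I u x (J u y) + I u (fderiv ℝ J u x y) := by
  have h := hI.hasFDerivAt.clm_apply (hJ.hasFDerivAt.clm_apply (hasFDerivAt_const y u))
  rw [h.fderiv]
  simp [add_comm]

theorem fderiv_form_apply (hB : DifferentiableAt ℝ B u) {a b : V → V} {a' b' : V →L[ℝ] V}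
    (ha : HasFDerivAt a a' u) (hb : HasFDerivAt b b' u) (x : V) :
    fderiv ℝ (fun v => B v (a v) (b v)) u x =
      fderiv ℝ B u x (a u) (b u) + B u (a' x) (b u) + B u (a u) (b' x) := by
  rw [((hB.hasFDerivAt.clm_apply ha).clm_apply hb).fderiv]
  simp
  ring

theorem fderiv_form_const_apply (hB : DifferentiableAt ℝ B u) (x y z : V) :
    fderiv ℝ B u x y z = fderiv ℝ (fun v => B v y z) u x := by
  simp [fderiv_form_apply hB (hasFDerivAt_const y u) (hasFDerivAt_const z u)]

theorem fderiv_form_left (hB : DifferentiableAt ℝ B u) (hJ : DifferentiableAt ℝ J u) (x y z : V) :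
    fderiv ℝ (fun v => B v (J v y) z) u x =
      fderiv ℝ B u x (J u y) z + B u (fderiv ℝ J u x y) z := by
  rw [fderiv_form_apply hB (hasFDerivAt_end_apply hJ (hasFDerivAt_const y u))
    (hasFDerivAt_const z u)]
  simp

theorem fderiv_form_right (hB : DifferentiableAt ℝ B u) (hJ : DifferentiableAt ℝ J u) (x y z : V) :
    fderiv ℝ (fun v => B v y (J v z)) u x =
      fderiv ℝ B u x y (J u z) + B u y (fderiv ℝ J u x z) := by
  rw [fderiv_form_apply hB (hasFDerivAt_const y u)
    (hasFDerivAt_end_apply hJ (hasFDerivAt_const z u))]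
  simp

theorem fderiv_form_both (hB : DifferentiableAt ℝ B u) (hJ : DifferentiableAt ℝ J u) (x y z : V) :
    fderiv ℝ (fun v => B v (J v y) (J v z)) u x =
      fderiv ℝ B u x (J u y) (J u z) + B u (fderiv ℝ J u x y) (J u z)
        + B u (J u y) (fderiv ℝ J u x z) := by
  rw [fderiv_form_apply hB (hasFDerivAt_end_apply hJ (hasFDerivAt_const y u))
    (hasFDerivAt_end_apply hJ (hasFDerivAt_const z u))]
  simp

theorem fderiv_anticomm (hJ : DifferentiableAt ℝ J u)
    (hsq : ∀ᶠ v in 𝓝 u, ∀ y, J v (J v y) = -y) (x y : V) :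
    fderiv ℝ J u x (J u y) = -J u (fderiv ℝ J u x y) := by
  have h : (fun v => J v (J v y)) =ᶠ[𝓝 u] fun _ => -y := hsq.mono fun v hv => hv y
  have h' := fderiv_end_end_apply hJ hJ x y
  rw [h.fderiv_eq, fderiv_fun_const] at h'
  exact eq_neg_of_add_eq_zero_left h'.symm

theorem fderiv_skew (hB : DifferentiableAt ℝ B u)
    (hskew : ∀ᶠ v in 𝓝 u, ∀ y z, B v y z = -B v z y) (x y z : V) :
    fderiv ℝ B u x y z = -fderiv ℝ B u x z y := by
  have h : (fun v => B v y z) =ᶠ[𝓝 u] fun v => -B v z y := hskew.mono fun v hv => hv y z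
  rw [fderiv_form_const_apply hB, h.fderiv_eq, fderiv_fun_neg, fderiv_form_const_apply hB]
  rfl

theorem differentiableAt_form_apply (hB : DifferentiableAt ℝ B u) {a b : V → V}
    (ha : DifferentiableAt ℝ a u) (hb : DifferentiableAt ℝ b u) :
    DifferentiableAt ℝ (fun v => B v (a v) (b v)) u :=
  (hB.clm_apply ha).clm_apply hb

/-- If the closed two-form `B` is of type `(2, 0) + (0, 2)` for the complex structure `J`, then
`B(J ·, ·)` is closed. -/
theorem cyclicDeriv_twist_eq_zero (hB : DifferentiableAt ℝ B u) (hJ : DifferentiableAt ℝ J u)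
    (hsq : ∀ᶠ v in 𝓝 u, ∀ y, J v (J v y) = -y)
    (hskew : ∀ᶠ v in 𝓝 u, ∀ y z, B v y z = -B v z y)
    (htype : ∀ᶠ v in 𝓝 u, ∀ y z, B v (J v y) z = B v y (J v z))
    (hN : ∀ x y, flatNijenhuis J u x y = 0) (hclosed : ∀ x y z, cyclicDeriv B u x y z = 0)
    {C : V → V →L[ℝ] V →L[ℝ] ℝ} (hC : DifferentiableAt ℝ C u)
    (hCB : ∀ᶠ v in 𝓝 u, ∀ y z, C v y z = B v (J v y) z) (x y z : V) :
    cyclicDeriv C u x y z = 0 := by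
  have hd : ∀ x y z, fderiv ℝ C u x y z = fderiv ℝ B u x (J u y) z + B u (fderiv ℝ J u x y) z := by
    intro x y z
    have h : (fun v => C v y z) =ᶠ[𝓝 u] fun v => B v (J v y) z := hCB.mono fun v hv => hv y z
    rw [fderiv_form_const_apply hC, h.fderiv_eq, fderiv_form_left hB hJ]
  simp only [cyclicDeriv, hd]
  refine cyclicSum_twist_eq_zero hsq.self_of_nhds (fderiv_anticomm hJ hsq) hN htype.self_of_nhds
    (fun x y z => ?_) hskew.self_of_nhds hclosed x y z
  have h : (fun v => B v (J v y) z) =ᶠ[𝓝 u] fun v => B v y (J v z) := htype.mono fun v hv => hv y z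
  rw [← fderiv_form_left hB hJ, h.fderiv_eq, fderiv_form_right hB hJ]

/-- For a closed two-form `B` and a complex structure `J`, the `(1, 1)`-form `C = B + B(J ·, J ·)`
satisfies `d^c C = dD` with `D = B(J ·, ·) + B(·, J ·)`. -/
theorem cyclicDeriv_oneOne (hB : DifferentiableAt ℝ B u) (hJ : DifferentiableAt ℝ J u)
    (hsq : ∀ᶠ v in 𝓝 u, ∀ y, J v (J v y) = -y)
    (hskew : ∀ y z, B u y z = -B u z y)
    (hN : ∀ x y, flatNijenhuis J u x y = 0) (hclosed : ∀ x y z, cyclicDeriv B u x y z = 0)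
    {C D : V → V →L[ℝ] V →L[ℝ] ℝ} (hC : DifferentiableAt ℝ C u) (hD : DifferentiableAt ℝ D u)
    (hCB : ∀ᶠ v in 𝓝 u, ∀ y z, C v y z = B v y z + B v (J v y) (J v z))
    (hDB : ∀ᶠ v in 𝓝 u, ∀ y z, D v y z = B v (J v y) z + B v y (J v z)) (x y z : V) :
    cyclicDeriv C u (J u x) (J u y) (J u z) = -cyclicDeriv D u x y z := by
  refine cyclicSum_oneOne (Dω := fun x y z => fderiv ℝ C u x y z)
    (Dβ := fun x y z => fderiv ℝ D u x y z) hsq.self_of_nhds (fderiv_anticomm hJ hsq) hN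
    hskew hclosed (fun x y z => ?_) (fun x y z => ?_) x y z
  · have h : (fun v => C v y z) =ᶠ[𝓝 u] fun v => B v y z + B v (J v y) (J v z) :=
      hCB.mono fun v hv => hv y z
    simp only [fderiv_form_const_apply hC, h.fderiv_eq, ← fderiv_form_both hB hJ]
    rw [fderiv_form_const_apply hB, fderiv_fun_add
      (differentiableAt_form_apply hB (by fun_prop) (by fun_prop))
      (differentiableAt_form_apply hB (by fun_prop) (by fun_prop))]
    rfl
  · have h : (fun v => D v y z) =ᶠ[𝓝 u] fun v => B v (J v y) z + B v y (J v z) :=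
      hDB.mono fun v hv => hv y z
    simp only [fderiv_form_const_apply hD, h.fderiv_eq, ← fderiv_form_left hB hJ,
      ← fderiv_form_right hB hJ]
    rw [fderiv_fun_add
      (differentiableAt_form_apply hB (by fun_prop) (by fun_prop))
      (differentiableAt_form_apply hB (by fun_prop) (by fun_prop))]
    rfl

/-- The derivative of the identity `g(J y, z) = -g(y, J z)`. -/
theorem fderiv_hermitian {g : V → V →L[ℝ] V →L[ℝ] ℝ} (hg : DifferentiableAt ℝ g u)
    (hJ : DifferentiableAt ℝ J u)
    (hskew : ∀ᶠ v in 𝓝 u, ∀ y z, g v (J v y) z = -g v y (J v z)) (x y z : V) :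
    fderiv ℝ g u x (J u y) z + g u (fderiv ℝ J u x y) z =
      -(fderiv ℝ g u x y (J u z) + g u y (fderiv ℝ J u x z)) := by
  have h : (fun v => g v (J v y) z) =ᶠ[𝓝 u] fun v => -g v y (J v z) := hskew.mono fun v hv => hv y z
  rw [← fderiv_form_left hg hJ, ← fderiv_form_right hg hJ, h.fderiv_eq, fderiv_fun_neg]
  rfl

/-- The form `B` defined by `B([I, J] y, z) = g(y, z)` is closed for a generalized Kähler structure
`(g, I, J)` with fundamental forms `WI`, `WJ`. -/
theorem cyclicDeriv_eq_zero_of_dc {g WI WJ : V → V →L[ℝ] V →L[ℝ] ℝ}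
    (hg : DifferentiableAt ℝ g u) (hB : DifferentiableAt ℝ B u)
    (hI : DifferentiableAt ℝ I u) (hJ : DifferentiableAt ℝ J u)
    (hWI : DifferentiableAt ℝ WI u) (hWJ : DifferentiableAt ℝ WJ u)
    (hsymm : ∀ᶠ v in 𝓝 u, ∀ y z, g v y z = g v z y)
    (hIsq : ∀ᶠ v in 𝓝 u, ∀ y, I v (I v y) = -y) (hJsq : ∀ᶠ v in 𝓝 u, ∀ y, J v (J v y) = -y)
    (hgI : ∀ᶠ v in 𝓝 u, ∀ y z, g v (I v y) z = -g v y (I v z))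
    (hgJ : ∀ᶠ v in 𝓝 u, ∀ y z, g v (J v y) z = -g v y (J v z))
    (hNI : ∀ x y, flatNijenhuis I u x y = 0) (hNJ : ∀ x y, flatNijenhuis J u x y = 0)
    (hWIg : ∀ᶠ v in 𝓝 u, ∀ y z, WI v y z = g v (I v y) z)
    (hWJg : ∀ᶠ v in 𝓝 u, ∀ y z, WJ v y z = g v (J v y) z)
    (hdc : ∀ x y z, cyclicDeriv WI u (I u x) (I u y) (I u z) =
      -cyclicDeriv WJ u (J u x) (J u y) (J u z))
    (hBg : ∀ᶠ v in 𝓝 u, ∀ y z, B v (I v (J v y) - J v (I v y)) z = g v y z)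
    (hBskew : ∀ y z, B u y z = -B u z y)
    (hsurj : ∀ x, ∃ y, x = I u (J u y) - J u (I u y)) (x y z : V) :
    cyclicDeriv B u x y z = 0 := by
  refine cyclicSum_symplectic_eq_zero (g := g u) (Dg := fderiv ℝ g u) (I := I u) (J := J u)
    (DI := fderiv ℝ I u) (DJ := fderiv ℝ J u)
    (ωI := fun x y z => fderiv ℝ WI u x y z) (ωJ := fun x y z => fderiv ℝ WJ u x y z)
    hsymm.self_of_nhds (fun x y z => ?_)
    hgI.self_of_nhds (fderiv_hermitian hg hI hgI) hIsq.self_of_nhds (fderiv_anticomm hI hIsq) hNI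
    hgJ.self_of_nhds (fderiv_hermitian hg hJ hgJ) hJsq.self_of_nhds (fderiv_anticomm hJ hJsq) hNJ
    (fun x y z => ?_) (fun x y z => ?_) hdc hBg.self_of_nhds hBskew
    (fun x y z => ?_) hsurj x y z
  · have h : (fun v => g v y z) =ᶠ[𝓝 u] fun v => g v z y := hsymm.mono fun v hv => hv y z
    rw [fderiv_form_const_apply hg, h.fderiv_eq, fderiv_form_const_apply hg]
  · have h : (fun v => WI v y z) =ᶠ[𝓝 u] fun v => g v (I v y) z := hWIg.mono fun v hv => hv y z
    simp only [fderiv_form_const_apply hWI, h.fderiv_eq, fderiv_form_left hg hI]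
  · have h : (fun v => WJ v y z) =ᶠ[𝓝 u] fun v => g v (J v y) z := hWJg.mono fun v hv => hv y z
    simp only [fderiv_form_const_apply hWJ, h.fderiv_eq, fderiv_form_left hg hJ]
  · have h : (fun v => B v (I v (J v y) - J v (I v y)) z) =ᶠ[𝓝 u] fun v => g v y z :=
      hBg.mono fun v hv => hv y z
    have hw := (hasFDerivAt_end_apply hI (hasFDerivAt_end_apply hJ (hasFDerivAt_const y u))).sub
      (hasFDerivAt_end_apply hJ (hasFDerivAt_end_apply hI (hasFDerivAt_const y u)))
    have h' := fderiv_form_apply hB hw (hasFDerivAt_const z u) x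
    simp only [Pi.sub_apply] at h'
    rw [h.fderiv_eq, ← fderiv_form_const_apply hg] at h'
    rw [h']
    simp [add_comm]

end Flat

/-! ### Hamiltonian isotopies of a vector space -/

section Flow

variable {V : Type*} [NormedAddCommGroup V] [NormedSpace ℝ V]

/-- The Cartan formula `d/dt Φ_t^* B = Φ_t^* (d (X_t ⌟ B) + X_t ⌟ dB) = 0` for the flow of a
Hamiltonian vector field. It is obtained without inverting `Φ_t`: `hham` expresses the Hamiltonian
equation pulled back by `Φ_t`, with `θ = f_t ∘ Φ_t`. Differentiating it in space and
antisymmetrizing removes the second derivatives of `θ`, and `dB = 0` turns the derivatives of `B` in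
space directions into the one along the flow. -/
theorem hasDerivAt_pullback_of_hamiltonian {B : V → V →L[ℝ] V →L[ℝ] ℝ} {Φ : ℝ × V → V} {θ : V → ℝ}
    {t : ℝ} {u : V} (hΦ : ContDiffAt ℝ 2 Φ (t, u)) (hθ : ContDiffAt ℝ 2 θ u)
    (hB : DifferentiableAt ℝ B (Φ (t, u)))
    (hskew : ∀ y z, B (Φ (t, u)) y z = -B (Φ (t, u)) z y)
    (hDskew : ∀ x y z, fderiv ℝ B (Φ (t, u)) x y z = -fderiv ℝ B (Φ (t, u)) x z y)
    (hclosed : ∀ x y z, cyclicDeriv B (Φ (t, u)) x y z = 0)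
    (hham : ∀ᶠ v in 𝓝 u, ∀ w, B (Φ (t, v)) (fderiv ℝ Φ (t, v) (1, 0)) (fderiv ℝ Φ (t, v) (0, w)) =
      -fderiv ℝ θ v w) (v w : V) :
    HasDerivAt (fun s => B (Φ (s, u)) (fderiv ℝ Φ (s, u) (0, v)) (fderiv ℝ Φ (s, u) (0, w)))
      0 t := by
  have hΦd : HasFDerivAt Φ (fderiv ℝ Φ (t, u)) (t, u) :=
    (hΦ.differentiableAt two_ne_zero).hasFDerivAt
  have hGd : HasFDerivAt (fderiv ℝ Φ) (fderiv ℝ (fderiv ℝ Φ) (t, u)) (t, u) :=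
    ((hΦ.fderiv_right (m := 1) (by norm_num)).differentiableAt one_ne_zero).hasFDerivAt
  have hsymm : IsSymmSndFDerivAt ℝ Φ (t, u) := hΦ.isSymmSndFDerivAt (by simp)
  have hθd : HasFDerivAt (fderiv ℝ θ) (fderiv ℝ (fderiv ℝ θ) u) u :=
    ((hθ.fderiv_right (m := 1) (by norm_num)).differentiableAt one_ne_zero).hasFDerivAt
  have hθs : IsSymmSndFDerivAt ℝ θ u := hθ.isSymmSndFDerivAt (by simp)
  -- differentiating in the time direction
  have hs : HasFDerivAt (fun s : ℝ => (s, u)) (ContinuousLinearMap.inl ℝ ℝ V) t :=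
    hasFDerivAt_prodMk_left t u
  have hx : HasFDerivAt (fun v : V => (t, v)) (ContinuousLinearMap.inr ℝ ℝ V) u :=
    hasFDerivAt_prodMk_right t u
  have hBt : HasFDerivAt (fun s : ℝ => B (Φ (s, u))) ((fderiv ℝ B (Φ (t, u))).comp
      ((fderiv ℝ Φ (t, u)).comp (ContinuousLinearMap.inl ℝ ℝ V))) t :=
    HasFDerivAt.comp (g := B) (f := fun s : ℝ => Φ (s, u)) t hB.hasFDerivAt (hΦd.comp t hs)
  have hBx : HasFDerivAt (fun v : V => B (Φ (t, v))) ((fderiv ℝ B (Φ (t, u))).comp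
      ((fderiv ℝ Φ (t, u)).comp (ContinuousLinearMap.inr ℝ ℝ V))) u :=
    HasFDerivAt.comp (g := B) (f := fun v : V => Φ (t, v)) u hB.hasFDerivAt (hΦd.comp u hx)
  have hGt : ∀ a, HasFDerivAt (fun s : ℝ => fderiv ℝ Φ (s, u) a)
      (((fderiv ℝ (fderiv ℝ Φ) (t, u)).comp (ContinuousLinearMap.inl ℝ ℝ V)).flip a) t := by
    intro a
    have h := (hGd.comp t hs).clm_apply (hasFDerivAt_const a t)
    rwa [ContinuousLinearMap.comp_zero, zero_add] at h
  have hGx : ∀ a, HasFDerivAt (fun v : V => fderiv ℝ Φ (t, v) a)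
      (((fderiv ℝ (fderiv ℝ Φ) (t, u)).comp (ContinuousLinearMap.inr ℝ ℝ V)).flip a) u := by
    intro a
    have h := (hGd.comp u hx).clm_apply (hasFDerivAt_const a u)
    rwa [ContinuousLinearMap.comp_zero, zero_add] at h
  -- the spatial derivative of the Hamiltonian equation
  have key : ∀ v w, fderiv ℝ B (Φ (t, u)) (fderiv ℝ Φ (t, u) (0, v)) (fderiv ℝ Φ (t, u) (1, 0))
        (fderiv ℝ Φ (t, u) (0, w))
      + B (Φ (t, u)) (fderiv ℝ (fderiv ℝ Φ) (t, u) (0, v) (1, 0)) (fderiv ℝ Φ (t, u) (0, w))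
      + B (Φ (t, u)) (fderiv ℝ Φ (t, u) (1, 0)) (fderiv ℝ (fderiv ℝ Φ) (t, u) (0, v) (0, w)) =
      -fderiv ℝ (fderiv ℝ θ) u v w := fun v w => by
    have h2 := (hBx.clm_apply (hGx (1, 0))).clm_apply (hGx (0, w))
    have h3 := h2.unique (((hθd.clm_apply (hasFDerivAt_const w u)).neg).congr_of_eventuallyEq
      (hham.mono fun v hv => hv w))
    have h4 := congrArg (· v) h3
    simp at h4
    linarith
  have k1 := key v w
  have k2 := key w v
  have h4 := ((hBt.clm_apply (hGt (0, v))).clm_apply (hGt (0, w))).hasDerivAt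
  refine h4.congr_deriv ?_
  have c := hclosed (fderiv ℝ Φ (t, u) (1, 0)) (fderiv ℝ Φ (t, u) (0, v)) (fderiv ℝ Φ (t, u) (0, w))
  have s1 := hsymm (1, 0) (0, v)
  have s2 := hsymm (1, 0) (0, w)
  have s3 := hsymm (0, v) (0, w)
  have s4 := hθs v w
  simp only [cyclicDeriv] at c
  rw [← s1, s3, s4] at k1
  rw [← s2] at k2
  simp
  linarith [hskew (fderiv ℝ Φ (t, u) (0, v)) ((fderiv ℝ (fderiv ℝ Φ) (t, u)) (1, 0) (0, w)),
    hDskew (fderiv ℝ Φ (t, u) (0, v)) (fderiv ℝ Φ (t, u) (1, 0)) (fderiv ℝ Φ (t, u) (0, w))]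

end Flow

/-! ### Tensor fields in charts -/

section Chart

/-- The model space of an `m`-dimensional manifold. -/
abbrev Model (m : ℕ) : Type := EuclideanSpace ℝ (Fin m)

variable {m : ℕ} {M : Type*} [TopologicalSpace M] [ChartedSpace (EuclideanSpace ℝ (Fin m)) M]

/-- The coordinate frame of the preferred chart at `x`, at the point with coordinates `u`: the
derivative of the inverse chart. -/
def chartFrame (x : M) (u : Model m) :
    Model m →L[ℝ] TangentSpace (𝓡 m) ((extChartAt (𝓡 m) x).symm u) :=
  mfderiv 𝓘(ℝ, Model m) (𝓡 m) (extChartAt (𝓡 m) x).symm u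

/-- The coordinate coframe of the preferred chart at `x`, at the point `y`: the derivative of the
chart. -/
def chartCoframe (x y : M) : TangentSpace (𝓡 m) y →L[ℝ] Model m :=
  mfderiv (𝓡 m) 𝓘(ℝ, Model m) (extChartAt (𝓡 m) x) y

/-- The coordinate representation of a field of endomorphisms in the preferred chart at `x`, at the
point with coordinates `u`. -/
def endRep (x : M) (J : EndField m M) (u : Model m) : Model m →L[ℝ] Model m :=
  chartCoframe x ((extChartAt (𝓡 m) x).symm u) ∘L J ((extChartAt (𝓡 m) x).symm u) ∘L chartFrame x u

/-- The coordinate representation of a field of bilinear forms in the preferred chart at `x`, at the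
point with coordinates `u`. -/
def bilinRep (x : M) (B : BilinField m M) (u : Model m) : Model m →L[ℝ] Model m →L[ℝ] ℝ :=
  ContinuousLinearMap.bilinearComp (E := Model m) (F := Model m)
    (B ((extChartAt (𝓡 m) x).symm u)) (chartFrame x u) (chartFrame x u)

theorem bilinRep_apply (x : M) (B : BilinField m M) (u a b : Model m) :
    bilinRep x B u a b = B ((extChartAt (𝓡 m) x).symm u) (chartFrame x u a) (chartFrame x u b) :=
  rfl

theorem endRep_apply (x : M) (J : EndField m M) (u a : Model m) :
    endRep x J u a = chartCoframe x ((extChartAt (𝓡 m) x).symm u)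
      (J ((extChartAt (𝓡 m) x).symm u) (chartFrame x u a)) :=
  rfl

theorem target_mem_nhds (x : M) : (extChartAt (𝓡 m) x).target ∈ 𝓝 (extChartAt (𝓡 m) x x) :=
  extChartAt_target_mem_nhds x

theorem contMDiffAt_iff_contDiffAt_chart {F : Type*} [NormedAddCommGroup F] [NormedSpace ℝ F]
    {h : M → F} {x : M} : ContMDiffAt (𝓡 m) 𝓘(ℝ, F) ∞ h x ↔
      ContDiffAt ℝ ∞ (h ∘ (extChartAt (𝓡 m) x).symm) (extChartAt (𝓡 m) x x) := by
  rw [contMDiffAt_iff_source, ModelWithCorners.range_eq_univ, contMDiffWithinAt_univ,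
    contMDiffAt_iff_contDiffAt]

theorem contDiffAt_congr {F G : Type*} [NormedAddCommGroup F] [NormedSpace ℝ F]
    [NormedAddCommGroup G] [NormedSpace ℝ G] {f g : F → G} {u : F} (h : f =ᶠ[𝓝 u] g) :
    ContDiffAt ℝ ∞ f u ↔ ContDiffAt ℝ ∞ g u :=
  ⟨fun hf => hf.congr_of_eventuallyEq h.symm, fun hg => hg.congr_of_eventuallyEq h⟩

variable [IsManifold (𝓡 m) ∞ M]

theorem chartFrame_coframe {x : M} {u : Model m} (hu : u ∈ (extChartAt (𝓡 m) x).target)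
    (v : TangentSpace (𝓡 m) ((extChartAt (𝓡 m) x).symm u)) :
    chartFrame x u (chartCoframe x ((extChartAt (𝓡 m) x).symm u) v) = v := by
  have : IsManifold (𝓡 m) 1 M := IsManifold.of_le (n := ∞) (by simp)
  have h := mfderivWithin_extChartAt_symm_comp_mfderiv_extChartAt (I := 𝓡 m) hu
  rw [ModelWithCorners.range_eq_univ, mfderivWithin_univ] at h
  exact congrArg (· v) h

theorem chartCoframe_frame {x : M} {u : Model m} (hu : u ∈ (extChartAt (𝓡 m) x).target)
    (a : Model m) :
    chartCoframe x ((extChartAt (𝓡 m) x).symm u) (chartFrame x u a) = a := by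
  have : IsManifold (𝓡 m) 1 M := IsManifold.of_le (n := ∞) (by simp)
  have h := mfderiv_extChartAt_comp_mfderivWithin_extChartAt_symm (I := 𝓡 m) hu
  rw [ModelWithCorners.range_eq_univ, mfderivWithin_univ] at h
  exact congrArg (· a) h

theorem endRep_endRep {x : M} {u : Model m} (hu : u ∈ (extChartAt (𝓡 m) x).target)
    (I J : EndField m M) (a : Model m) :
    endRep x I u (endRep x J u a) = endRep x (fun y => I y ∘L J y) u a := by
  simp only [endRep_apply, chartFrame_coframe hu]
  rfl

theorem bilinRep_endRep {x : M} {u : Model m} (hu : u ∈ (extChartAt (𝓡 m) x).target)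
    (B : BilinField m M) (J : EndField m M) (a b : Model m) :
    bilinRep x B u (endRep x J u a) b = bilinRep x (fun y => B y ∘L J y) u a b := by
  simp only [bilinRep_apply, endRep_apply, chartFrame_coframe hu]
  rfl

/-- A field of endomorphisms is smooth if and only if, for every `x`, its representation in the
preferred chart at `x` is smooth at `x` itself. -/
theorem isSmoothEnd_iff (J : EndField m M) :
    IsSmoothEnd J ↔ ∀ x : M, ContDiffAt ℝ ∞ (endRep x J) (extChartAt (𝓡 m) x x) := by
  have : IsManifold (𝓡 m) 1 M := IsManifold.of_le (n := ∞) (by simp)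
  refine forall_congr' fun x => ?_
  refine (contMDiffAt_hom_bundle _).trans ((and_iff_right contMDiffAt_id).trans ?_)
  refine contMDiffAt_iff_contDiffAt_chart.trans (contDiffAt_congr ?_)
  filter_upwards [target_mem_nhds x] with u hu
  have hs : (extChartAt (𝓡 m) x).symm u ∈ (chartAt (Model m) x).source := by
    simpa using (extChartAt (𝓡 m) x).map_target hu
  simp only [Function.comp_apply, ContinuousLinearMap.inCoordinates]
  rw [TangentBundle.continuousLinearMapAt_trivializationAt hs,
    TangentBundle.symmL_trivializationAt hs, ModelWithCorners.range_eq_univ, mfderivWithin_univ,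
    (extChartAt (𝓡 m) x).right_inv hu]
  rfl

/-- A field of bilinear forms is smooth if and only if, for every `x`, its representation in the
preferred chart at `x` is smooth at `x` itself. -/
theorem contMDiff_bilin_iff (B : BilinField m M) :
    ContMDiff (𝓡 m) ((𝓡 m).prod 𝓘(ℝ, Model m →L[ℝ] Model m →L[ℝ] ℝ)) ∞
      (fun x => Bundle.TotalSpace.mk' (Model m →L[ℝ] Model m →L[ℝ] ℝ)
        (E := fun x : M => TangentSpace (𝓡 m) x →L[ℝ] TangentSpace (𝓡 m) x →L[ℝ] ℝ) x (B x)) ↔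
      ∀ x : M, ContDiffAt ℝ ∞ (bilinRep x B) (extChartAt (𝓡 m) x x) := by
  have : IsManifold (𝓡 m) 1 M := IsManifold.of_le (n := ∞) (by simp)
  refine forall_congr' fun x => ?_
  refine (contMDiffAt_hom_bundle _).trans ((and_iff_right contMDiffAt_id).trans ?_)
  refine contMDiffAt_iff_contDiffAt_chart.trans (contDiffAt_congr ?_)
  filter_upwards [target_mem_nhds x] with u hu
  have hs : (extChartAt (𝓡 m) x).symm u ∈ (chartAt (Model m) x).source := by
    simpa using (extChartAt (𝓡 m) x).map_target hu
  ext a b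
  simp only [Function.comp_apply]
  rw [inCoordinates_apply_eq₂ hs hs (by simp)]
  have h := TangentBundle.symmL_trivializationAt (I := 𝓡 m) hs
  rw [ModelWithCorners.range_eq_univ, mfderivWithin_univ, (extChartAt (𝓡 m) x).right_inv hu] at h
  rw [bilinRep_apply]
  have h' : ∀ c, (trivializationAt (Model m) (TangentSpace (𝓡 m)) x).symm
      ((extChartAt (𝓡 m) x).symm u) c = chartFrame x u c := fun c => by
    rw [chartFrame, ← h]
    exact (Bundle.Trivialization.symmL_apply _ hs _).symm
  rw [h', h']
  simp

end Chart

/-! ### Vector fields and integrability in charts -/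

section ChartPoint

variable {m : ℕ} {M : Type*} [TopologicalSpace M] [ChartedSpace (EuclideanSpace ℝ (Fin m)) M]
  [IsManifold (𝓡 m) ∞ M]

theorem endRep_chartCoframe {x y : M} (hy : y ∈ (extChartAt (𝓡 m) x).source) (J : EndField m M)
    (v : TangentSpace (𝓡 m) y) :
    endRep x J (extChartAt (𝓡 m) x y) (chartCoframe x y v) = chartCoframe x y (J y v) := by
  obtain ⟨u, hu, rfl⟩ : ∃ u ∈ (extChartAt (𝓡 m) x).target, (extChartAt (𝓡 m) x).symm u = y :=
    ⟨_, (extChartAt (𝓡 m) x).map_source hy, (extChartAt (𝓡 m) x).left_inv hy⟩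
  rw [(extChartAt (𝓡 m) x).right_inv hu, endRep_apply, chartFrame_coframe hu]

theorem bilinRep_chartCoframe {x y : M} (hy : y ∈ (extChartAt (𝓡 m) x).source) (B : BilinField m M)
    (v w : TangentSpace (𝓡 m) y) :
    bilinRep x B (extChartAt (𝓡 m) x y) (chartCoframe x y v) (chartCoframe x y w) = B y v w := by
  obtain ⟨u, hu, rfl⟩ : ∃ u ∈ (extChartAt (𝓡 m) x).target, (extChartAt (𝓡 m) x).symm u = y :=
    ⟨_, (extChartAt (𝓡 m) x).map_source hy, (extChartAt (𝓡 m) x).left_inv hy⟩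
  rw [(extChartAt (𝓡 m) x).right_inv hu, bilinRep_apply, chartFrame_coframe hu,
    chartFrame_coframe hu]

theorem chartCoframe_surjective {x y : M} (hy : y ∈ (extChartAt (𝓡 m) x).source) (a : Model m) :
    ∃ v : TangentSpace (𝓡 m) y, chartCoframe x y v = a := by
  obtain ⟨u, hu, rfl⟩ : ∃ u ∈ (extChartAt (𝓡 m) x).target, (extChartAt (𝓡 m) x).symm u = y :=
    ⟨_, (extChartAt (𝓡 m) x).map_source hy, (extChartAt (𝓡 m) x).left_inv hy⟩
  exact ⟨chartFrame x u a, chartCoframe_frame hu a⟩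

theorem chartCoframe_injective {x y : M} (hy : y ∈ (extChartAt (𝓡 m) x).source) :
    Function.Injective (chartCoframe x y : TangentSpace (𝓡 m) y → Model m) := by
  obtain ⟨u, hu, rfl⟩ : ∃ u ∈ (extChartAt (𝓡 m) x).target, (extChartAt (𝓡 m) x).symm u = y :=
    ⟨_, (extChartAt (𝓡 m) x).map_source hy, (extChartAt (𝓡 m) x).left_inv hy⟩
  exact Function.LeftInverse.injective (g := chartFrame x u) (chartFrame_coframe hu)

theorem isInvertible_chartCoframe {x y : M} (hy : y ∈ (extChartAt (𝓡 m) x).source) :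
    (chartCoframe x y : TangentSpace (𝓡 m) y →L[ℝ] Model m).IsInvertible := by
  have : IsManifold (𝓡 m) 1 M := IsManifold.of_le (n := ∞) (by simp)
  exact isInvertible_mfderiv_extChartAt hy

/-- The coordinate representation of a vector field in the preferred chart at `x`. -/
def vecRep (x : M) (X : ∀ y : M, TangentSpace (𝓡 m) y) (u : Model m) : Model m :=
  chartCoframe x ((extChartAt (𝓡 m) x).symm u) (X ((extChartAt (𝓡 m) x).symm u))

theorem vecRep_end {x : M} {u : Model m} (hu : u ∈ (extChartAt (𝓡 m) x).target) (J : EndField m M)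
    (X : ∀ y : M, TangentSpace (𝓡 m) y) :
    vecRep x (fun y => J y (X y)) u = endRep x J u (vecRep x X u) := by
  rw [vecRep, vecRep, endRep_apply, chartFrame_coframe hu]

theorem inverse_chartFrame {x : M} {u : Model m} (hu : u ∈ (extChartAt (𝓡 m) x).target) :
    (chartFrame x u).inverse = chartCoframe x ((extChartAt (𝓡 m) x).symm u) :=
  ContinuousLinearMap.inverse_eq (ContinuousLinearMap.ext (chartFrame_coframe hu))
    (ContinuousLinearMap.ext (chartCoframe_frame hu))

theorem chartCoframe_mlieBracket (x : M) (X Y : ∀ y : M, TangentSpace (𝓡 m) y) :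
    chartCoframe x x (VectorField.mlieBracket (𝓡 m) X Y x) =
      VectorField.lieBracket ℝ (vecRep x X) (vecRep x Y) (extChartAt (𝓡 m) x x) := by
  have : IsManifold (𝓡 m) 1 M := IsManifold.of_le (n := ∞) (by simp)
  have hrep : ∀ X : ∀ y : M, TangentSpace (𝓡 m) y,
      VectorField.mpullbackWithin 𝓘(ℝ, Model m) (𝓡 m) (extChartAt (𝓡 m) x).symm X Set.univ
        =ᶠ[𝓝 (extChartAt (𝓡 m) x x)] vecRep x X := fun X => by
    filter_upwards [target_mem_nhds x] with u hu
    rw [VectorField.mpullbackWithin_apply, mfderivWithin_univ]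
    exact congrArg (· (X ((extChartAt (𝓡 m) x).symm u))) (inverse_chartFrame hu)
  rw [← VectorField.mlieBracketWithin_univ, VectorField.mlieBracketWithin_apply,
    ModelWithCorners.range_eq_univ, Set.preimage_univ, Set.univ_inter]
  have h := Filter.EventuallyEq.lieBracketWithin_vectorField_eq_nhds (𝕜 := ℝ)
    (s := Set.univ) (hrep X) (hrep Y)
  rw [VectorField.lieBracketWithin_univ (𝕜 := ℝ) (V := vecRep x X)] at h
  rw [← h]
  exact (isInvertible_chartCoframe (mem_extChartAt_source x)).self_apply_inverse _

theorem smoothFieldAt_of_vecRep_const (x : M) (X : ∀ y : M, TangentSpace (𝓡 m) y) (a : Model m)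
    (h : ∀ᶠ y in 𝓝 x, chartCoframe x y (X y) = a) : SmoothFieldAt X x := by
  have : IsManifold (𝓡 m) 1 M := IsManifold.of_le (n := ∞) (by simp)
  refine (Bundle.contMDiffAt_section x).2 (contMDiffAt_const (c := a) |>.congr_of_eventuallyEq ?_)
  filter_upwards [h, (chartAt (Model m) x).open_source.mem_nhds (mem_chart_source _ x)] with y hy hs
  rw [← hy, chartCoframe, ← TangentBundle.continuousLinearMapAt_trivializationAt hs]
  exact (Bundle.Trivialization.continuousLinearMapAt_apply_of_mem ℝ _ hs _).symm

theorem IsComplexStructure.differentiableAt {J : EndField m M} (hJ : IsComplexStructure J) (x : M) :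
    DifferentiableAt ℝ (endRep x J) (extChartAt (𝓡 m) x x) :=
  ((isSmoothEnd_iff J).1 hJ.smooth x).differentiableAt (by simp)

/-- Integrability, applied to the coordinate vector fields of a chart, makes the Nijenhuis tensor of
the coordinate representation vanish. -/
theorem IsComplexStructure.flatNijenhuis_eq_zero {J : EndField m M} (hJ : IsComplexStructure J)
    (x : M) (a b : Model m) :
    flatNijenhuis (endRep x J) (extChartAt (𝓡 m) x x) a b = 0 := by
  set X : Model m → ∀ y : M, TangentSpace (𝓡 m) y := fun a y => (chartCoframe x y).inverse a
  have : IsManifold (𝓡 m) 1 M := IsManifold.of_le (n := ∞) (by simp)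
  have hX : ∀ a, ∀ y ∈ (extChartAt (𝓡 m) x).source, chartCoframe x y (X a y) = a := fun a y hy => by
    exact (isInvertible_chartCoframe hy).self_apply_inverse _
  have hXs : ∀ a, SmoothFieldAt (X a) x := fun a => smoothFieldAt_of_vecRep_const x _ a <| by
    filter_upwards [extChartAt_source_mem_nhds (I := 𝓡 m) x] with y hy using hX a y hy
  have hXr : ∀ a, vecRep x (X a) =ᶠ[𝓝 (extChartAt (𝓡 m) x x)] fun _ => a := fun a => by
    filter_upwards [target_mem_nhds x] with u hu
    exact hX a _ ((extChartAt (𝓡 m) x).map_target hu)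
  have hJXr : ∀ a, vecRep x (fun y => J y (X a y)) =ᶠ[𝓝 (extChartAt (𝓡 m) x x)]
      fun u => endRep x J u a := fun a => by
    filter_upwards [target_mem_nhds x, hXr a] with u hu hu'
    rw [vecRep_end hu, hu']
  have hd := hJ.differentiableAt x
  have hf : ∀ a c, fderiv ℝ (fun u => endRep x J u a) (extChartAt (𝓡 m) x x) c =
      fderiv ℝ (endRep x J) (extChartAt (𝓡 m) x x) c a := fun a c => by
    rw [(hasFDerivAt_end_apply hd (hasFDerivAt_const a _)).fderiv]
    simp
  have h := congrArg (chartCoframe x x) (hJ.integrable x (X a) (X b) (hXs a) (hXs b))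
  have hx := mem_extChartAt_source (I := 𝓡 m) x
  simp only [nijenhuis, map_sub, map_zero, ← endRep_chartCoframe hx, chartCoframe_mlieBracket] at h
  rw [(hJXr a).lieBracket_vectorField_eq (hJXr b), (hJXr a).lieBracket_vectorField_eq (hXr b),
    (hXr a).lieBracket_vectorField_eq (hJXr b), (hXr a).lieBracket_vectorField_eq (hXr b)] at h
  simpa only [VectorField.lieBracket, hf, flatNijenhuis, fderiv_fun_const, zero_apply,
    Pi.zero_apply, zero_sub, sub_zero, map_neg, sub_neg_eq_add] using h

end ChartPoint

/-! ### Exterior derivatives of two-forms in charts -/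

section Forms

theorem minSmoothness_two_le : minSmoothness ℝ 2 ≤ ∞ := by
  rw [minSmoothness_of_isRCLikeNormedField]
  exact ENat.LEInfty.out

/-- The linear map sending a bilinear form `A` to the alternating form
`(v, w) ↦ (A v w - A w v) / 2`. -/
def alternation (V : Type*) [NormedAddCommGroup V] [NormedSpace ℝ V] :
    (V →L[ℝ] V →L[ℝ] ℝ) →L[ℝ] (V [⋀^Fin 2]→L[ℝ] ℝ) :=
  (1 / 2 : ℝ) • (ContinuousAlternatingMap.alternatizeUncurryFinCLM ℝ V ℝ).comp
    (ContinuousLinearMap.compL ℝ V (V →L[ℝ] ℝ) (V [⋀^Fin 1]→L[ℝ] ℝ)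
      (ContinuousAlternatingMap.ofSubsingletonLIE (𝕜 := ℝ) (E := V) (F := ℝ)
        (0 : Fin 1)).toContinuousLinearEquiv.toContinuousLinearMap)

theorem alternation_apply {V : Type*} [NormedAddCommGroup V] [NormedSpace ℝ V]
    {A : V →L[ℝ] V →L[ℝ] ℝ} (hA : ∀ a, A a a = 0) (v : Fin 2 → V) :
    alternation V A v = A (v 0) (v 1) := by
  have hskew : A (v 1) (v 0) = -A (v 0) (v 1) := by
    have h := hA (v 0 + v 1)
    simp only [map_add, add_apply, hA] at h
    linarith
  have : alternation V A v = (1 / 2) * (A (v 0) (v 1) - A (v 1) (v 0)) := by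
    simp [alternation, ContinuousAlternatingMap.alternatizeUncurryFin_apply, Fin.sum_univ_two,
      Fin.removeNth, sub_eq_add_neg]
  rw [this, hskew]
  ring

theorem extDeriv_alternation {V : Type*} [NormedAddCommGroup V] [NormedSpace ℝ V]
    {A : V → V →L[ℝ] V →L[ℝ] ℝ} {u : V} (hA : DifferentiableAt ℝ A u)
    (hA0 : ∀ v a, A v a a = 0) (v : Fin 3 → V) :
    extDeriv (fun w => alternation V (A w)) u v = cyclicDeriv A u (v 0) (v 1) (v 2) := by
  have hd : DifferentiableAt ℝ (fun w => alternation V (A w)) u := by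
    have h := (alternation V).differentiableAt (x := A u)
    exact h.comp u hA
  have hskew : ∀ w a b, A w a b = -A w b a := fun w a b => by
    have h := hA0 w (a + b)
    simp only [map_add, add_apply, hA0] at h
    linarith
  rw [extDeriv_apply hd]
  simp only [alternation_apply (hA0 _), ← fderiv_form_const_apply hA]
  simp [Fin.sum_univ_three, Fin.removeNth, cyclicDeriv, Fin.succAbove]
  rw [fderiv_skew hA (.of_forall hskew) (v 1)]
  ring

variable {m : ℕ} {M : Type*} [TopologicalSpace M] [ChartedSpace (EuclideanSpace ℝ (Fin m)) M]

/-- The two-form on `M` defined by a field of alternating bilinear forms. -/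
def twoForm (B : BilinField m M) (hB : ∀ x v, B x v v = 0) : FormField m M 2 := fun x =>
  toTwoForm (B x) (hB x)

/-- The coordinate representation of a differential form in the preferred chart at `x`. -/
def formRep {k : ℕ} (x : M) (η : FormField m M k) (u : Model m) : Model m [⋀^Fin k]→L[ℝ] ℝ :=
  (η ((extChartAt (𝓡 m) x).symm u)).compContinuousLinearMap (chartFrame x u)

theorem formRep_twoForm_apply (B : BilinField m M) (hB : ∀ x v, B x v v = 0) (x : M)
    (u : Model m) (v : Fin 2 → Model m) :
    formRep x (twoForm B hB) u v = bilinRep x B u (v 0) (v 1) :=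
  rfl

theorem bilinRep_self {B : BilinField m M} (hB : ∀ x v, B x v v = 0) (x : M) (u a : Model m) :
    bilinRep x B u a a = 0 :=
  hB _ _

theorem formRep_twoForm (B : BilinField m M) (hB : ∀ x v, B x v v = 0) (x : M) :
    formRep x (twoForm B hB) = fun u => alternation (Model m) (bilinRep x B u) := by
  funext u
  refine ContinuousAlternatingMap.ext fun v => ?_
  rw [formRep_twoForm_apply, alternation_apply (bilinRep_self hB x u)]

theorem extDer_apply {k : ℕ} (η : FormField m M k) (x : M)
    (v : Fin (k + 1) → TangentSpace (𝓡 m) x) :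
    extDer η x v = extDeriv (formRep x η) (extChartAt (𝓡 m) x x) fun i => chartCoframe x x (v i) :=
  rfl

theorem extDer_twoForm {B : BilinField m M} (hB : ∀ x v, B x v v = 0) {x : M}
    (hd : DifferentiableAt ℝ (bilinRep x B) (extChartAt (𝓡 m) x x))
    (v : Fin 3 → TangentSpace (𝓡 m) x) :
    extDer (twoForm B hB) x v = cyclicDeriv (bilinRep x B) (extChartAt (𝓡 m) x x)
      (chartCoframe x x (v 0)) (chartCoframe x x (v 1)) (chartCoframe x x (v 2)) := by
  rw [extDer_apply, formRep_twoForm, extDeriv_alternation hd (bilinRep_self hB x)]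

theorem contDiffAt_formRep_twoForm {B : BilinField m M} (hB : ∀ x v, B x v v = 0) {x : M}
    {u : Model m} (h : ContDiffAt ℝ ∞ (bilinRep x B) u) :
    ContDiffAt ℝ ∞ (formRep x (twoForm B hB)) u := by
  rw [formRep_twoForm]
  exact (alternation (Model m)).contDiff.contDiffAt.comp u h

variable [IsManifold (𝓡 m) ∞ M]

theorem formRep_chartCoframe {k : ℕ} {x y : M} (hy : y ∈ (extChartAt (𝓡 m) x).source)
    (η : FormField m M k) (v : Fin k → TangentSpace (𝓡 m) y) :
    formRep x η (extChartAt (𝓡 m) x y) (fun i => chartCoframe x y (v i)) = η y v := by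
  obtain ⟨u, hu, rfl⟩ : ∃ u ∈ (extChartAt (𝓡 m) x).target, (extChartAt (𝓡 m) x).symm u = y :=
    ⟨_, (extChartAt (𝓡 m) x).map_source hy, (extChartAt (𝓡 m) x).left_inv hy⟩
  rw [(extChartAt (𝓡 m) x).right_inv hu, formRep,
    ContinuousAlternatingMap.compContinuousLinearMap_apply]
  congr 1
  ext1 i
  exact chartFrame_coframe hu (v i)

theorem contMDiffAt_chartSymm {x : M} {u : Model m} (hu : u ∈ (extChartAt (𝓡 m) x).target) :
    ContMDiffAt 𝓘(ℝ, Model m) (𝓡 m) ∞ (extChartAt (𝓡 m) x).symm u :=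
  (contMDiffOn_extChartAt_symm x).contMDiffAt ((isOpen_extChartAt_target x).mem_nhds hu)

theorem contMDiffAt_chart {x y : M} (hy : y ∈ (extChartAt (𝓡 m) x).source) :
    ContMDiffAt (𝓡 m) 𝓘(ℝ, Model m) ∞ (extChartAt (𝓡 m) x) y :=
  contMDiffAt_extChartAt' (by simpa using hy)

theorem contDiffAt_mapRep {f : M → M} {x y : M} {u : Model m}
    (hu : u ∈ (extChartAt (𝓡 m) x).target)
    (hf : ContMDiffAt (𝓡 m) (𝓡 m) ∞ f ((extChartAt (𝓡 m) x).symm u))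
    (hy : f ((extChartAt (𝓡 m) x).symm u) ∈ (extChartAt (𝓡 m) y).source) :
    ContDiffAt ℝ ∞ (fun w => extChartAt (𝓡 m) y (f ((extChartAt (𝓡 m) x).symm w))) u :=
  (((contMDiffAt_chart hy).comp _ hf).comp u (contMDiffAt_chartSymm hu)).contDiffAt

theorem fderiv_mapRep {f : M → M} {x y : M} {u : Model m}
    (hu : u ∈ (extChartAt (𝓡 m) x).target)
    (hf : MDifferentiableAt (𝓡 m) (𝓡 m) f ((extChartAt (𝓡 m) x).symm u))
    (hy : f ((extChartAt (𝓡 m) x).symm u) ∈ (extChartAt (𝓡 m) y).source) (a : Model m) :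
    fderiv ℝ (fun w => extChartAt (𝓡 m) y (f ((extChartAt (𝓡 m) x).symm w))) u a =
      chartCoframe y (f ((extChartAt (𝓡 m) x).symm u))
        (mfderiv (𝓡 m) (𝓡 m) f ((extChartAt (𝓡 m) x).symm u) (chartFrame x u a)) := by
  have h1 := ((contMDiffAt_chart hy).mdifferentiableAt (by simp)).hasMFDerivAt
  have h2 := ((contMDiffAt_chartSymm hu).mdifferentiableAt (by simp)).hasMFDerivAt
  let L : Model m →L[ℝ] Model m := chartCoframe y (f ((extChartAt (𝓡 m) x).symm u)) ∘L
    mfderiv (𝓡 m) (𝓡 m) f ((extChartAt (𝓡 m) x).symm u) ∘L chartFrame x u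
  have h : HasFDerivAt (fun w => extChartAt (𝓡 m) y (f ((extChartAt (𝓡 m) x).symm w))) L u :=
    hasMFDerivAt_iff_hasFDerivAt.1 (h1.comp u (hf.hasMFDerivAt.comp u h2))
  exact congrArg (fun T : Model m →L[ℝ] Model m => T a) h.fderiv

theorem formRep_change {k : ℕ} (η : FormField m M k) {x y : M} {u : Model m}
    (hu : u ∈ (extChartAt (𝓡 m) x).target)
    (hy : (extChartAt (𝓡 m) x).symm u ∈ (extChartAt (𝓡 m) y).source) :
    formRep x η u =
      (formRep y η (extChartAt (𝓡 m) y ((extChartAt (𝓡 m) x).symm u))).compContinuousLinearMap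
        (fderiv ℝ (fun w => extChartAt (𝓡 m) y ((extChartAt (𝓡 m) x).symm w)) u) := by
  ext v
  have h := formRep_chartCoframe hy η fun i => chartFrame x u (v i)
  rw [ContinuousAlternatingMap.compContinuousLinearMap_apply]
  refine h.symm.trans (congrArg _ ?_)
  ext1 i
  have h' := fderiv_mapRep (f := id) hu mdifferentiableAt_id hy (v i)
  rw [mfderiv_id] at h'
  exact h'.symm

/-- The exterior derivative of `η` is represented in the chart at `x` by the exterior derivative of
the representation of `η`, also away from `x`. -/
theorem formRep_extDer {k : ℕ} (η : FormField m M k) {x : M} {u : Model m}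
    (hu : u ∈ (extChartAt (𝓡 m) x).target)
    (hη : DifferentiableAt ℝ (formRep ((extChartAt (𝓡 m) x).symm u) η)
      (extChartAt (𝓡 m) ((extChartAt (𝓡 m) x).symm u) ((extChartAt (𝓡 m) x).symm u))) :
    formRep x (extDer η) u = extDeriv (formRep x η) u := by
  set y := (extChartAt (𝓡 m) x).symm u with hydef
  have hy : y ∈ (extChartAt (𝓡 m) y).source := mem_extChartAt_source y
  have hev : formRep x η =ᶠ[𝓝 u] fun w =>
      (formRep y η (extChartAt (𝓡 m) y ((extChartAt (𝓡 m) x).symm w))).compContinuousLinearMap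
        (fderiv ℝ (fun w => extChartAt (𝓡 m) y ((extChartAt (𝓡 m) x).symm w)) w) := by
    filter_upwards [(isOpen_extChartAt_target x).mem_nhds hu,
      (contMDiffAt_chartSymm hu).continuousAt.preimage_mem_nhds
        (extChartAt_source_mem_nhds (I := 𝓡 m) y)] with w hw hw'
    exact formRep_change η hw hw'
  -- near `u`, the representation in the chart at `x` is the pullback of that in the chart at `y`
  rw [hev.extDeriv_eq, extDeriv_pullback (r := ∞)
    (f := fun w => extChartAt (𝓡 m) y ((extChartAt (𝓡 m) x).symm w)) hη
    (contDiffAt_mapRep (f := id) hu contMDiffAt_id hy)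
    (minSmoothness_two_le)]
  ext v
  rw [ContinuousAlternatingMap.compContinuousLinearMap_apply, formRep,
    ContinuousAlternatingMap.compContinuousLinearMap_apply, extDer_apply]
  refine congrArg _ ?_
  ext1 i
  have h' := fderiv_mapRep (f := id) hu mdifferentiableAt_id hy (v i)
  rw [mfderiv_id] at h'
  exact h'.symm

/-- `d ∘ d = 0` for two-forms. As `extDer` uses a different chart at each point, this needs the
naturality of the exterior derivative under changes of charts, `formRep_extDer`. -/
theorem extDer_extDer_twoForm {B : BilinField m M} (hB : ∀ x v, B x v v = 0)
    (h : ∀ x : M, ContDiffAt ℝ ∞ (bilinRep x B) (extChartAt (𝓡 m) x x)) :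
    extDer (extDer (twoForm B hB)) = 0 := by
  ext x v
  have hev : formRep x (extDer (twoForm B hB)) =ᶠ[𝓝 (extChartAt (𝓡 m) x x)]
      extDeriv (formRep x (twoForm B hB)) := by
    filter_upwards [target_mem_nhds x] with u hu
    exact formRep_extDer _ hu ((contDiffAt_formRep_twoForm hB (h _)).differentiableAt (by simp))
  rw [extDer_apply, hev.extDeriv_eq, extDeriv_extDeriv_apply (contDiffAt_formRep_twoForm hB (h x))
    minSmoothness_two_le]
  rfl

end Forms

/-! ### The symplectic form of a nondegenerate generalized Kähler structure -/

section Fibre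

variable {V : Type*} [NormedAddCommGroup V] [NormedSpace ℝ V] [FiniteDimensional ℝ V]

theorem isInvertible_of_injective {W : Type*} [NormedAddCommGroup W] [NormedSpace ℝ W]
    [FiniteDimensional ℝ W] (h : Module.finrank ℝ V = Module.finrank ℝ W) {T : V →L[ℝ] W}
    (hT : ∀ v, T v = 0 → v = 0) : T.IsInvertible :=
  ⟨(LinearEquiv.ofInjectiveOfFinrankEq (T : V →ₗ[ℝ] W)
    ((injective_iff_map_eq_zero _).2 hT) h).toContinuousLinearEquiv, by ext; rfl⟩

theorem finrank_dual : Module.finrank ℝ (V →L[ℝ] ℝ) = Module.finrank ℝ V := by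
  rw [← (LinearMap.toContinuousLinearMap : (V →ₗ[ℝ] ℝ) ≃ₗ[ℝ] (V →L[ℝ] ℝ)).finrank_eq]
  exact Subspace.dual_finrank_eq

theorem isInvertible_of_pos {G : V →L[ℝ] V →L[ℝ] ℝ} (hG : ∀ v, v ≠ 0 → 0 < G v v) :
    G.IsInvertible := by
  refine isInvertible_of_injective finrank_dual.symm fun v hv => ?_
  by_contra h
  have := hG v h
  simp [hv] at this

/-- If `σ = P ∘ G⁻¹` is nondegenerate then `P` is invertible, and `Ω = σ⁻¹` satisfies
`Ω(P v, ·) = G(v, ·)`. -/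
theorem inverse_sigma_apply {G : V →L[ℝ] V →L[ℝ] ℝ} (hG : ∀ v, v ≠ 0 → 0 < G v v)
    {P : V →L[ℝ] V}
    (hσ : ∀ α : V →L[ℝ] ℝ, (∀ β : V →L[ℝ] ℝ, β ((P ∘L G.inverse) α) = 0) → α = 0) :
    P.IsInvertible ∧ ∀ v, (P ∘L G.inverse).inverse (P v) = G v := by
  have hGi := isInvertible_of_pos hG
  have hi : (P ∘L G.inverse).IsInvertible :=
    isInvertible_of_injective finrank_dual fun α h => hσ α fun β => by rw [h, map_zero]
  have hP : ∀ v, (P ∘L G.inverse) (G v) = P v := fun v => by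
    rw [ContinuousLinearMap.comp_apply, hGi.inverse_apply_self]
  refine ⟨isInvertible_of_injective rfl fun v hv => ?_, fun v => ?_⟩
  · have h := hP v
    rw [hv] at h
    have h1 : G v = 0 := by rw [← hi.inverse_apply_self (G v), h, map_zero]
    rw [← hGi.inverse_apply_self v, h1, map_zero]
  · rw [← hP v, hi.inverse_apply_self]

/-- Conversely, a form `Ω` with `Ω(P v, ·) = G(v, ·)` is the inverse of `σ = P ∘ G⁻¹`, which is then
nondegenerate. -/
theorem inverse_sigma_eq {G Ω : V →L[ℝ] V →L[ℝ] ℝ} (hG : ∀ v, v ≠ 0 → 0 < G v v)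
    {P : V →L[ℝ] V} (h : ∀ v, Ω (P v) = G v) :
    (P ∘L G.inverse).inverse = Ω ∧
      ∀ α : V →L[ℝ] ℝ, (∀ β : V →L[ℝ] ℝ, β ((P ∘L G.inverse) α) = 0) → α = 0 := by
  have hGi := isInvertible_of_pos hG
  have hPi : P.IsInvertible := isInvertible_of_injective rfl fun v hv => by
    have h1 := h v
    rw [hv, map_zero] at h1
    rw [← hGi.inverse_apply_self v, ← h1, map_zero]
  have hl : ∀ α, Ω ((P ∘L G.inverse) α) = α := fun α => by
    rw [ContinuousLinearMap.comp_apply, h, hGi.self_apply_inverse]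
  refine ⟨ContinuousLinearMap.inverse_eq ?_ ?_, fun α hα => ?_⟩
  · ext v : 1
    obtain ⟨w, rfl⟩ : ∃ w, P w = v := ⟨_, hPi.self_apply_inverse v⟩
    simp only [ContinuousLinearMap.comp_apply, h, hGi.inverse_apply_self,
      ContinuousLinearMap.id_apply]
  · exact ContinuousLinearMap.ext hl
  · have h0 : (P ∘L G.inverse) α = 0 := by
      by_contra hne
      obtain ⟨β, hβ⟩ := SeparatingDual.exists_ne_zero (R := ℝ) hne
      exact hβ (hα β)
    rw [← hl α, h0, map_zero]

end Fibre

section Symplectic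

variable {m : ℕ} {M : Type*} [TopologicalSpace M] [ChartedSpace (EuclideanSpace ℝ (Fin m)) M]

/-- The commutator `[I, J]` of two fields of endomorphisms. -/
def commEnd (I J : EndField m M) : EndField m M := fun x => I x ∘L J x - J x ∘L I x

theorem commEnd_apply (I J : EndField m M) (x : M) (v : TangentSpace (𝓡 m) x) :
    commEnd I J x v = I x (J x v) - J x (I x v) :=
  rfl

theorem commEnd_left {I : EndField m M} (hI : ∀ x v, I x (I x v) = -v) (J : EndField m M) (x : M)
    (v : TangentSpace (𝓡 m) x) : commEnd I J x (I x v) = -I x (commEnd I J x v) := by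
  simp only [commEnd_apply, map_sub, hI, map_neg]
  abel

theorem commEnd_right (I : EndField m M) {J : EndField m M} (hJ : ∀ x v, J x (J x v) = -v) (x : M)
    (v : TangentSpace (𝓡 m) x) : commEnd I J x (J x v) = -J x (commEnd I J x v) := by
  simp only [commEnd_apply, map_sub, hJ, map_neg]
  abel

theorem bilinRep_swap {B : BilinField m M} (h : ∀ y v w, B y v w = -B y w v) (x : M)
    (u a b : Model m) : bilinRep x B u a b = -bilinRep x B u b a := by
  simp only [bilinRep_apply]
  exact h _ _ _

theorem bilinRep_comm {B : BilinField m M} (h : ∀ y v w, B y v w = B y w v) (x : M)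
    (u a b : Model m) : bilinRep x B u a b = bilinRep x B u b a := by
  simp only [bilinRep_apply]
  exact h _ _ _

variable [IsManifold (𝓡 m) ∞ M]

theorem IsHermitian.skew {g : Metric m M} {J : EndField m M} (h : IsHermitian g J) (x : M)
    (v w : TangentSpace (𝓡 m) x) : g.inner x (J x v) w = -g.inner x v (J x w) := by
  rw [← h.compat x v (J x w), h.sq, map_neg, neg_neg]

theorem inner_commEnd {g : Metric m M} {I J : EndField m M} (hI : IsHermitian g I)
    (hJ : IsHermitian g J) (x : M) (v w : TangentSpace (𝓡 m) x) :
    g.inner x (commEnd I J x v) w = -g.inner x v (commEnd I J x w) := by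
  simp only [commEnd_apply, map_sub, sub_apply, hI.skew, hJ.skew]
  abel

variable {g : Metric m M} {I J : EndField m M}

theorem IsNondegGK.isInvertible_commEnd (h : IsNondegGK g I J) (x : M) :
    (commEnd I J x).IsInvertible :=
  (inverse_sigma_apply (V := Model m) (G := g.inner x) (P := commEnd I J x) (g.pos x)
    (h.nondeg x)).1

theorem IsNondegGK.Omega_commEnd (h : IsNondegGK g I J) (x : M) (v w : TangentSpace (𝓡 m) x) :
    Omega g I J x (commEnd I J x v) w = g.inner x v w :=
  congrArg (fun α : Model m →L[ℝ] ℝ => α w) <|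
    (inverse_sigma_apply (V := Model m) (G := g.inner x) (P := commEnd I J x) (g.pos x)
      (h.nondeg x)).2 v

theorem IsNondegGK.exists_commEnd (h : IsNondegGK g I J) (x : M) (v : TangentSpace (𝓡 m) x) :
    ∃ w, commEnd I J x w = v :=
  (h.isInvertible_commEnd x).surjective v

theorem IsNondegGK.Omega_skew (h : IsNondegGK g I J) (x : M) (v w : TangentSpace (𝓡 m) x) :
    Omega g I J x v w = -Omega g I J x w v := by
  obtain ⟨v, rfl⟩ := h.exists_commEnd x v
  obtain ⟨w, rfl⟩ := h.exists_commEnd x w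
  rw [h.Omega_commEnd, h.Omega_commEnd, g.symm, inner_commEnd h.hermitian_I h.hermitian_J]

theorem IsNondegGK.Omega_left (h : IsNondegGK g I J) (x : M) (v w : TangentSpace (𝓡 m) x) :
    Omega g I J x (I x v) w = Omega g I J x v (I x w) := by
  obtain ⟨v, rfl⟩ := h.exists_commEnd x v
  have h1 := commEnd_left h.complex_I.sq J x v
  rw [← neg_eq_iff_eq_neg] at h1
  rw [← h1, map_neg, neg_apply, h.Omega_commEnd, h.Omega_commEnd, h.hermitian_I.skew, neg_neg]

theorem IsNondegGK.Omega_right (h : IsNondegGK g I J) (x : M) (v w : TangentSpace (𝓡 m) x) :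
    Omega g I J x (J x v) w = Omega g I J x v (J x w) := by
  obtain ⟨v, rfl⟩ := h.exists_commEnd x v
  have h1 := commEnd_right I h.complex_J.sq x v
  rw [← neg_eq_iff_eq_neg] at h1
  rw [← h1, map_neg, neg_apply, h.Omega_commEnd, h.Omega_commEnd, h.hermitian_J.skew, neg_neg]

theorem Metric.contDiffAt (g : Metric m M) (x : M) :
    ContDiffAt ℝ ∞ (bilinRep x g.inner) (extChartAt (𝓡 m) x x) :=
  (contMDiff_bilin_iff _).1 g.contMDiff x

theorem IsComplexStructure.contDiffAt (hJ : IsComplexStructure J) (x : M) :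
    ContDiffAt ℝ ∞ (endRep x J) (extChartAt (𝓡 m) x x) :=
  (isSmoothEnd_iff J).1 hJ.smooth x

theorem endRep_commEnd {x : M} {u : Model m} (hu : u ∈ (extChartAt (𝓡 m) x).target) :
    endRep x (commEnd I J) u =
      endRep x I u ∘L endRep x J u - endRep x J u ∘L endRep x I u := by
  ext1 a
  rw [sub_apply, ContinuousLinearMap.comp_apply, ContinuousLinearMap.comp_apply,
    endRep_endRep hu, endRep_endRep hu]
  simp only [endRep_apply, commEnd_apply, map_sub, ContinuousLinearMap.comp_apply]

theorem contDiffAt_commEnd {x : M} (hI : ContDiffAt ℝ ∞ (endRep x I) (extChartAt (𝓡 m) x x))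
    (hJ : ContDiffAt ℝ ∞ (endRep x J) (extChartAt (𝓡 m) x x)) :
    ContDiffAt ℝ ∞ (endRep x (commEnd I J)) (extChartAt (𝓡 m) x x) := by
  refine ((hI.clm_comp hJ).sub (hJ.clm_comp hI)).congr_of_eventuallyEq ?_
  filter_upwards [target_mem_nhds x] with u hu using endRep_commEnd hu

theorem bilinRep_endRep_eq {x : M} {u : Model m} (hu : u ∈ (extChartAt (𝓡 m) x).target)
    {B B' : BilinField m M} {J : EndField m M} (h : ∀ y v w, B y (J y v) w = B' y v w)
    (a b : Model m) : bilinRep x B u (endRep x J u a) b = bilinRep x B' u a b := by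
  simp only [bilinRep_apply, endRep_apply, chartFrame_coframe hu, h]

theorem endRep_sq {x : M} {u : Model m} (hu : u ∈ (extChartAt (𝓡 m) x).target)
    (hJ : ∀ y v, J y (J y v) = -v) (a : Model m) : endRep x J u (endRep x J u a) = -a := by
  simp only [endRep_apply, chartFrame_coframe hu, hJ, map_neg, chartCoframe_frame hu]

theorem bilinRep_endRep_skew {x : M} {u : Model m} (hu : u ∈ (extChartAt (𝓡 m) x).target)
    {B : BilinField m M} (h : ∀ y v w, B y (J y v) w = -B y v (J y w)) (a b : Model m) :
    bilinRep x B u (endRep x J u a) b = -bilinRep x B u a (endRep x J u b) := by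
  simp only [bilinRep_apply, endRep_apply, chartFrame_coframe hu, h]

theorem bilinRep_endRep_symm {x : M} {u : Model m} (hu : u ∈ (extChartAt (𝓡 m) x).target)
    {B : BilinField m M} (h : ∀ y v w, B y (J y v) w = B y v (J y w)) (a b : Model m) :
    bilinRep x B u (endRep x J u a) b = bilinRep x B u a (endRep x J u b) := by
  simp only [bilinRep_apply, endRep_apply, chartFrame_coframe hu, h]

theorem isInvertible_endRep {x : M} {u : Model m} (hu : u ∈ (extChartAt (𝓡 m) x).target)
    (hJ : ∀ y v, J y v = 0 → v = 0) : (endRep x J u).IsInvertible := by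
  refine isInvertible_of_injective rfl fun a ha => ?_
  rw [endRep_apply] at ha
  have h1 := hJ _ _ (chartCoframe_injective ((extChartAt (𝓡 m) x).map_target hu)
    (ha.trans (map_zero _).symm))
  rw [← chartCoframe_frame hu a, h1, map_zero]

theorem contDiffAt_clm_inverse {V E : Type*} [NormedAddCommGroup V] [NormedSpace ℝ V]
    [CompleteSpace V] [NormedAddCommGroup E] [NormedSpace ℝ E] {T : E → V →L[ℝ] V} {u : E}
    (hT : ContDiffAt ℝ ∞ T u)
    (hi : (T u).IsInvertible) : ContDiffAt ℝ ∞ (fun v => (T v).inverse) u := by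
  obtain ⟨e, he⟩ := hi
  have h := contDiffAt_map_inverse (𝕜 := ℝ) (n := ∞) e
  rw [he] at h
  exact h.comp u hT

theorem IsNondegGK.contDiffAt_Omega (h : IsNondegGK g I J) (x : M) :
    ContDiffAt ℝ ∞ (bilinRep x (Omega g I J)) (extChartAt (𝓡 m) x x) := by
  have hinj : ∀ y v, commEnd I J y v = 0 → v = 0 := fun y v hv =>
    (h.isInvertible_commEnd y).injective (hv.trans (map_zero _).symm)
  have hP := contDiffAt_commEnd (h.complex_I.contDiffAt x) (h.complex_J.contDiffAt x)
  have hx := mem_of_mem_nhds (target_mem_nhds (m := m) x)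
  refine ((g.contDiffAt x).clm_comp
    (contDiffAt_clm_inverse hP (isInvertible_endRep hx hinj))).congr_of_eventuallyEq ?_
  filter_upwards [target_mem_nhds x] with u hu
  refine ContinuousLinearMap.ext fun a => ContinuousLinearMap.ext fun b => ?_
  obtain ⟨a, rfl⟩ := (isInvertible_endRep hu hinj).surjective a
  rw [ContinuousLinearMap.comp_apply, (isInvertible_endRep hu hinj).inverse_apply_self]
  exact bilinRep_endRep_eq hu h.Omega_commEnd a b

theorem contDiffAt_bilinRep_comp {x : M} {B : BilinField m M}
    (hB : ContDiffAt ℝ ∞ (bilinRep x B) (extChartAt (𝓡 m) x x))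
    (hJ : ContDiffAt ℝ ∞ (endRep x J) (extChartAt (𝓡 m) x x)) :
    ContDiffAt ℝ ∞ (bilinRep x fun y => B y ∘L J y) (extChartAt (𝓡 m) x x) := by
  refine (hB.clm_comp hJ).congr_of_eventuallyEq ?_
  filter_upwards [target_mem_nhds x] with u hu
  refine ContinuousLinearMap.ext fun a => ContinuousLinearMap.ext fun b => ?_
  rw [ContinuousLinearMap.comp_apply, bilinRep_endRep hu]

/-- The value of `d^c ω_J` in the preferred chart. -/
theorem dc_fundamentalForm_apply (hJ : IsComplexStructure J) (hgJ : IsHermitian g J) (x : M)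
    (v : Fin 3 → TangentSpace (𝓡 m) x) : dc J (fundamentalForm g J hgJ) x v =
      -cyclicDeriv (bilinRep x fun y => g.inner y ∘L J y) (extChartAt (𝓡 m) x x)
        (endRep x J (extChartAt (𝓡 m) x x) (chartCoframe x x (v 0)))
        (endRep x J (extChartAt (𝓡 m) x x) (chartCoframe x x (v 1)))
        (endRep x J (extChartAt (𝓡 m) x x) (chartCoframe x x (v 2))) := by
  simp only [endRep_chartCoframe (mem_extChartAt_source (I := 𝓡 m) x)]
  exact congrArg Neg.neg (extDer_twoForm hgJ.self_eq_zero
    ((contDiffAt_bilinRep_comp (g.contDiffAt x) (hJ.contDiffAt x)).differentiableAt (by simp))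
    fun i => J x (v i))

/-- The form `Ω` of a nondegenerate generalized Kähler structure is closed. -/
theorem IsNondegGK.cyclicDeriv_Omega (h : IsNondegGK g I J) (x : M) (a b c : Model m) :
    cyclicDeriv (bilinRep x (Omega g I J)) (extChartAt (𝓡 m) x x) a b c = 0 := by
  have hT := target_mem_nhds (m := m) x
  have hx := mem_extChartAt_source (I := 𝓡 m) x
  have hd : ∀ {J : EndField m M}, IsComplexStructure J →
      DifferentiableAt ℝ (bilinRep x fun y => g.inner y ∘L J y) (extChartAt (𝓡 m) x x) :=
    fun hJ => (contDiffAt_bilinRep_comp (g.contDiffAt x) (hJ.contDiffAt x)).differentiableAt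
      (by simp)
  refine cyclicDeriv_eq_zero_of_dc (g := bilinRep x g.inner) (I := endRep x I) (J := endRep x J)
    (WI := bilinRep x fun y => g.inner y ∘L I y) (WJ := bilinRep x fun y => g.inner y ∘L J y)
    ((g.contDiffAt x).differentiableAt (by simp))
    ((h.contDiffAt_Omega x).differentiableAt (by simp)) (h.complex_I.differentiableAt x)
    (h.complex_J.differentiableAt x) (hd h.complex_I) (hd h.complex_J)
    (.of_forall fun u => bilinRep_comm g.symm x u) ?_ ?_ ?_ ?_
    (h.complex_I.flatNijenhuis_eq_zero x) (h.complex_J.flatNijenhuis_eq_zero x) ?_ ?_ ?_ ?_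
    (bilinRep_swap h.Omega_skew x _) ?_ a b c
  · filter_upwards [hT] with u hu using endRep_sq hu h.complex_I.sq
  · filter_upwards [hT] with u hu using endRep_sq hu h.complex_J.sq
  · filter_upwards [hT] with u hu using bilinRep_endRep_skew hu h.hermitian_I.skew
  · filter_upwards [hT] with u hu using bilinRep_endRep_skew hu h.hermitian_J.skew
  · filter_upwards [hT] with u hu y z
    rw [bilinRep_endRep hu]
  · filter_upwards [hT] with u hu y z
    rw [bilinRep_endRep hu]
  · intro a b c
    obtain ⟨a, rfl⟩ := chartCoframe_surjective hx a
    obtain ⟨b, rfl⟩ := chartCoframe_surjective hx b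
    obtain ⟨c, rfl⟩ := chartCoframe_surjective hx c
    have h1 := congrArg (fun η : FormField m M 3 => η x ![a, b, c]) h.dc_eq
    have h2 : ∀ η : FormField m M 3, (-η) x ![a, b, c] = -η x ![a, b, c] := fun η => rfl
    simp only [h2, dc_fundamentalForm_apply h.complex_I, dc_fundamentalForm_apply h.complex_J] at h1
    simpa using congrArg Neg.neg h1
  · filter_upwards [hT] with u hu y z
    have h1 := congrArg (fun T : Model m →L[ℝ] Model m => T y) (endRep_commEnd (I := I) (J := J) hu)
    simp only [sub_apply, ContinuousLinearMap.comp_apply] at h1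
    rw [← h1]
    exact bilinRep_endRep_eq hu h.Omega_commEnd y z
  · intro a
    have hu := mem_of_mem_nhds hT
    have hinj : ∀ y v, commEnd I J y v = 0 → v = 0 := fun y v hv =>
      (h.isInvertible_commEnd y).injective (hv.trans (map_zero _).symm)
    obtain ⟨b, rfl⟩ := (isInvertible_endRep hu hinj).surjective a
    exact ⟨b, by rw [endRep_commEnd hu]; rfl⟩

end Symplectic

/-! ### Invariance of a symplectic form under a Hamiltonian flow -/

section HamiltonianFlow

variable {m : ℕ} {M : Type*} [TopologicalSpace M] [ChartedSpace (EuclideanSpace ℝ (Fin m)) M]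
  {B : BilinField m M} {S : Set ℝ} {f : ℝ → M → ℝ}
  {φ : ℝ → M ≃ₘ^∞⟮𝓡 m, 𝓡 m⟯ M}

theorem IsHamiltonianFlow.contMDiff_f (h : IsHamiltonianFlow B S f φ) {t : ℝ} (ht : t ∈ S) :
    ContMDiff (𝓡 m) 𝓘(ℝ, ℝ) ∞ (f t) := fun x => by
  have h2 := h.smooth_f.contMDiffAt (x := (t, x))
    ((h.isOpen.prod isOpen_univ).mem_nhds ⟨ht, trivial⟩)
  exact ContMDiffAt.comp (f := fun x => (t, x)) x h2 (contMDiffAt_const.prodMk contMDiffAt_id)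

variable [IsManifold (𝓡 m) ∞ M]

/-- The coordinate representation `(t, u) ↦ φ_t(u)` of a family of diffeomorphisms, from the
preferred chart at `x` to that at `y`. -/
def flowRep (φ : ℝ → M ≃ₘ^∞⟮𝓡 m, 𝓡 m⟯ M) (x y : M) (p : ℝ × Model m) : Model m :=
  extChartAt (𝓡 m) y (φ p.1 ((extChartAt (𝓡 m) x).symm p.2))

theorem IsHamiltonianFlow.contMDiffAt (h : IsHamiltonianFlow B S f φ) {x : M} {p : ℝ × Model m}
    (ht : p.1 ∈ S) (hu : p.2 ∈ (extChartAt (𝓡 m) x).target) :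
    ContMDiffAt 𝓘(ℝ, ℝ × Model m) (𝓡 m) ∞
      (fun p : ℝ × Model m => φ p.1 ((extChartAt (𝓡 m) x).symm p.2)) p := by
  have h1 : ContMDiffAt 𝓘(ℝ, ℝ × Model m) (𝓘(ℝ, ℝ).prod (𝓡 m)) ∞
      (fun p : ℝ × Model m => (p.1, (extChartAt (𝓡 m) x).symm p.2)) p :=
    contDiff_fst.contMDiff.contMDiffAt.prodMk
      (ContMDiffAt.comp p (contMDiffAt_chartSymm hu) contDiff_snd.contMDiff.contMDiffAt)
  have h2 := h.smooth_flow.contMDiffAt (x := (p.1, (extChartAt (𝓡 m) x).symm p.2))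
    ((h.isOpen.prod isOpen_univ).mem_nhds ⟨ht, trivial⟩)
  exact ContMDiffAt.comp p h2 h1

theorem IsHamiltonianFlow.contDiffAt_flowRep (h : IsHamiltonianFlow B S f φ) {x y : M}
    {p : ℝ × Model m} (ht : p.1 ∈ S) (hu : p.2 ∈ (extChartAt (𝓡 m) x).target)
    (hy : φ p.1 ((extChartAt (𝓡 m) x).symm p.2) ∈ (extChartAt (𝓡 m) y).source) :
    ContDiffAt ℝ ∞ (flowRep φ x y) p :=
  (ContMDiffAt.comp p (contMDiffAt_chart hy) (h.contMDiffAt ht hu)).contDiffAt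

theorem IsHamiltonianFlow.fderiv_flowRep_space (h : IsHamiltonianFlow B S f φ) {x y : M} {t : ℝ}
    {u : Model m} (ht : t ∈ S) (hu : u ∈ (extChartAt (𝓡 m) x).target)
    (hy : φ t ((extChartAt (𝓡 m) x).symm u) ∈ (extChartAt (𝓡 m) y).source) (a : Model m) :
    fderiv ℝ (flowRep φ x y) (t, u) (0, a) = chartCoframe y (φ t ((extChartAt (𝓡 m) x).symm u))
      (mfderiv (𝓡 m) (𝓡 m) (φ t) ((extChartAt (𝓡 m) x).symm u) (chartFrame x u a)) := by
  rw [← fderiv_mapRep hu ((φ t).mdifferentiable (by simp) _) hy a]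
  have h1 := ((h.contDiffAt_flowRep (p := (t, u)) ht hu hy).differentiableAt (by simp)).hasFDerivAt
  have h2 := h1.comp u (hasFDerivAt_prodMk_right t u)
  exact congrArg (fun T : Model m →L[ℝ] Model m => T a) h2.fderiv.symm

theorem IsHamiltonianFlow.fderiv_flowRep_time (h : IsHamiltonianFlow B S f φ) {x y : M} {t : ℝ}
    {u : Model m} (ht : t ∈ S) (hu : u ∈ (extChartAt (𝓡 m) x).target)
    (hy : φ t ((extChartAt (𝓡 m) x).symm u) ∈ (extChartAt (𝓡 m) y).source)
    {X : TangentSpace (𝓡 m) (φ t ((extChartAt (𝓡 m) x).symm u))}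
    (hX : HasMFDerivAt 𝓘(ℝ, ℝ) (𝓡 m) (fun s : ℝ => φ s ((extChartAt (𝓡 m) x).symm u)) t
      ((1 : ℝ →L[ℝ] ℝ).smulRight X)) :
    fderiv ℝ (flowRep φ x y) (t, u) (1, 0) =
      chartCoframe y (φ t ((extChartAt (𝓡 m) x).symm u)) X := by
  have h1 := ((h.contDiffAt_flowRep (p := (t, u)) ht hu hy).differentiableAt (by simp)).hasFDerivAt
  have h2 := h1.comp t (hasFDerivAt_prodMk_left (𝕜 := ℝ) t u)
  have h3 := ((contMDiffAt_chart hy).mdifferentiableAt (by simp)).hasMFDerivAt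
  let L : ℝ →L[ℝ] Model m := (1 : ℝ →L[ℝ] ℝ).smulRight
    (chartCoframe y (φ t ((extChartAt (𝓡 m) x).symm u)) X)
  have h4 : HasFDerivAt (fun s => extChartAt (𝓡 m) y (φ s ((extChartAt (𝓡 m) x).symm u))) L t := by
    have h5 := hasMFDerivAt_iff_hasFDerivAt.1 (HasMFDerivAt.comp t h3 hX)
    refine h5.congr_fderiv ?_
    ext
    exact (map_smul (chartCoframe y (φ t ((extChartAt (𝓡 m) x).symm u))) (1 : ℝ) X).trans rfl
  have h6 := congrArg (fun T : ℝ →L[ℝ] Model m => T 1) (h2.unique h4)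
  simpa [L] using h6

/-- The pullback `φ_s^* B` is stationary at every time `t`, as computed in the chart at the moving
point `φ_t(p)`. -/
theorem IsHamiltonianFlow.hasDerivAt_pullback (h : IsHamiltonianFlow B S f φ)
    (hB : ∀ x, ContDiffAt ℝ ∞ (bilinRep x B) (extChartAt (𝓡 m) x x))
    (hskew : ∀ x v w, B x v w = -B x w v)
    (hclosed : ∀ x a b c, cyclicDeriv (bilinRep x B) (extChartAt (𝓡 m) x x) a b c = 0)
    {x : M} {t : ℝ} {u : Model m} (ht : t ∈ S) (hu : u ∈ (extChartAt (𝓡 m) x).target)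
    (a b : Model m) :
    HasDerivAt (fun s => B (φ s ((extChartAt (𝓡 m) x).symm u))
      (mfderiv (𝓡 m) (𝓡 m) (φ s) ((extChartAt (𝓡 m) x).symm u) (chartFrame x u a))
      (mfderiv (𝓡 m) (𝓡 m) (φ s) ((extChartAt (𝓡 m) x).symm u) (chartFrame x u b))) 0 t := by
  set y := φ t ((extChartAt (𝓡 m) x).symm u) with hy
  have hys : φ t ((extChartAt (𝓡 m) x).symm u) ∈ (extChartAt (𝓡 m) y).source :=
    mem_extChartAt_source y
  have hev : ∀ᶠ p : ℝ × Model m in 𝓝 (t, u), p.1 ∈ S ∧ p.2 ∈ (extChartAt (𝓡 m) x).target ∧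
      φ p.1 ((extChartAt (𝓡 m) x).symm p.2) ∈ (extChartAt (𝓡 m) y).source := by
    have h1 := (h.contMDiffAt (p := (t, u)) ht hu).continuousAt
    refine (continuousAt_fst.eventually (h.isOpen.mem_nhds ht)).and
      ((continuousAt_snd.eventually ((isOpen_extChartAt_target x).mem_nhds hu)).and
      (h1.eventually (extChartAt_source_mem_nhds (I := 𝓡 m) y)))
  have hevt : ∀ᶠ s in 𝓝 t, s ∈ S ∧ u ∈ (extChartAt (𝓡 m) x).target ∧
      φ s ((extChartAt (𝓡 m) x).symm u) ∈ (extChartAt (𝓡 m) y).source :=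
    (continuousAt_id.prodMk continuousAt_const).eventually hev
  have hevu : ∀ᶠ v in 𝓝 u, t ∈ S ∧ v ∈ (extChartAt (𝓡 m) x).target ∧
      φ t ((extChartAt (𝓡 m) x).symm v) ∈ (extChartAt (𝓡 m) y).source :=
    (continuousAt_const.prodMk continuousAt_id).eventually hev
  obtain ⟨X, hXf, hX⟩ := h.generated
  have hBd : DifferentiableAt ℝ (bilinRep y B) (flowRep φ x y (t, u)) :=
    (hB y).differentiableAt (by simp)
  have hθ : ∀ v ∈ (extChartAt (𝓡 m) x).target, ContMDiffAt 𝓘(ℝ, Model m) 𝓘(ℝ, ℝ) ∞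
      (fun v => f t (φ t ((extChartAt (𝓡 m) x).symm v))) v := fun v hv =>
    ((h.contMDiff_f ht).contMDiffAt.comp _ (φ t).contMDiff.contMDiffAt).comp v
      (contMDiffAt_chartSymm hv)
  have key := hasDerivAt_pullback_of_hamiltonian (B := bilinRep y B) (Φ := flowRep φ x y)
    (θ := fun v => f t (φ t ((extChartAt (𝓡 m) x).symm v))) (t := t) (u := u)
    ((h.contDiffAt_flowRep (p := (t, u)) ht hu hys).of_le ENat.LEInfty.out)
    ((hθ u hu).contDiffAt.of_le ENat.LEInfty.out) hBd (bilinRep_swap hskew y _)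
    (fderiv_skew hBd (.of_forall (bilinRep_swap hskew y))) (hclosed y) ?_ a b
  · refine key.congr_of_eventuallyEq ?_
    filter_upwards [hevt] with s hs
    rw [h.fderiv_flowRep_space hs.1 hs.2.1 hs.2.2, h.fderiv_flowRep_space hs.1 hs.2.1 hs.2.2]
    exact (bilinRep_chartCoframe hs.2.2 B _ _).symm
  · filter_upwards [hevu] with v hv w
    rw [h.fderiv_flowRep_space hv.1 hv.2.1 hv.2.2, h.fderiv_flowRep_time hv.1 hv.2.1 hv.2.2
      (hX t ht _)]
    refine (bilinRep_chartCoframe hv.2.2 B _ _).trans ?_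
    rw [← neg_eq_iff_eq_neg, ← hXf t ht]
    have h1 := ((h.contMDiff_f ht).mdifferentiable (by simp)
      (φ t ((extChartAt (𝓡 m) x).symm v))).hasMFDerivAt
    have h2 := ((φ t).mdifferentiable (by simp) ((extChartAt (𝓡 m) x).symm v)).hasMFDerivAt
    have h3 := ((contMDiffAt_chartSymm hv.2.1).mdifferentiableAt (by simp)).hasMFDerivAt
    let L : Model m →L[ℝ] ℝ := mfderiv (𝓡 m) 𝓘(ℝ, ℝ) (f t) (φ t ((extChartAt (𝓡 m) x).symm v)) ∘L
      mfderiv (𝓡 m) (𝓡 m) (φ t) ((extChartAt (𝓡 m) x).symm v) ∘L chartFrame x v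
    have h4 : HasFDerivAt (fun v => f t (φ t ((extChartAt (𝓡 m) x).symm v))) L v :=
      hasMFDerivAt_iff_hasFDerivAt.1 (h1.comp v (h2.comp v h3))
    exact congrArg (fun T : Model m →L[ℝ] ℝ => T w) h4.fderiv.symm

/-- A Hamiltonian flow preserves the symplectic form. -/
theorem IsHamiltonianFlow.pullback_eq (h : IsHamiltonianFlow B S f φ)
    (hB : ∀ x, ContDiffAt ℝ ∞ (bilinRep x B) (extChartAt (𝓡 m) x x))
    (hskew : ∀ x v w, B x v w = -B x w v)
    (hclosed : ∀ x a b c, cyclicDeriv (bilinRep x B) (extChartAt (𝓡 m) x x) a b c = 0)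
    {t : ℝ} (ht : t ∈ S) (x : M) (v w : TangentSpace (𝓡 m) x) :
    B (φ t x) (mfderiv (𝓡 m) (𝓡 m) (φ t) x v) (mfderiv (𝓡 m) (𝓡 m) (φ t) x w) = B x v w := by
  obtain ⟨z, u, hu, rfl⟩ : ∃ z : M, ∃ u ∈ (extChartAt (𝓡 m) z).target,
      (extChartAt (𝓡 m) z).symm u = x :=
    ⟨x, _, (extChartAt (𝓡 m) x).map_source (mem_extChartAt_source x),
      (extChartAt (𝓡 m) x).left_inv (mem_extChartAt_source x)⟩
  obtain ⟨a, rfl⟩ : ∃ a, chartFrame z u a = v := ⟨_, chartFrame_coframe hu v⟩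
  obtain ⟨b, rfl⟩ : ∃ b, chartFrame z u b = w := ⟨_, chartFrame_coframe hu w⟩
  -- `S` is connected, so the pullback at time `t` agrees with the one at time `0`
  have hd := fun s (hs : s ∈ S) => h.hasDerivAt_pullback hB hskew hclosed hs hu a b
  have hc := h.isOpen.is_const_of_deriv_eq_zero h.ordConnected.isPreconnected
    (fun s hs => (hd s hs).differentiableAt.differentiableWithinAt) (fun s hs => (hd s hs).deriv)
    ht h.zero_mem
  refine hc.trans ?_
  have hid : ∀ ψ : M → M, ψ = id → ∀ (x : M) (v w : TangentSpace (𝓡 m) x),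
      B (ψ x) (mfderiv (𝓡 m) (𝓡 m) ψ x v) (mfderiv (𝓡 m) (𝓡 m) ψ x w) = B x v w := by
    rintro _ rfl x v w
    rw [mfderiv_id]
    rfl
  exact hid _ (funext h.start) _ _ _

end HamiltonianFlow

/-! ### Pulling back a complex structure by a diffeomorphism -/

section Pullback

variable {m : ℕ} {M : Type*} [TopologicalSpace M] [ChartedSpace (EuclideanSpace ℝ (Fin m)) M]

theorem mfderiv_symm_mfderiv (ψ : M ≃ₘ^∞⟮𝓡 m, 𝓡 m⟯ M) (x : M) (v : TangentSpace (𝓡 m) x) :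
    mfderiv (𝓡 m) (𝓡 m) ψ.symm (ψ x) (mfderiv (𝓡 m) (𝓡 m) ψ x v) = v := by
  have h1 := (ψ.mdifferentiable (by simp) x).hasMFDerivAt
  have h2 := (ψ.symm.mdifferentiable (by simp) (ψ x)).hasMFDerivAt
  have h3 := h2.comp x h1
  have h4 : (ψ.symm ∘ ψ : M → M) = id := funext ψ.symm_apply_apply
  rw [h4] at h3
  exact congrArg (fun T : Model m →L[ℝ] Model m => T v)
    (hasMFDerivAt_unique h3 (hasMFDerivAt_id x))

theorem isInvertible_mfderiv_diffeomorph (ψ : M ≃ₘ^∞⟮𝓡 m, 𝓡 m⟯ M) (x : M) :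
    (mfderiv (𝓡 m) (𝓡 m) ψ x).IsInvertible := by
  refine isInvertible_of_injective (V := Model m) (W := Model m) rfl fun v hv => ?_
  exact (mfderiv_symm_mfderiv ψ x v).symm.trans
    ((congrArg (mfderiv (𝓡 m) (𝓡 m) ψ.symm (ψ x)) hv).trans (map_zero _))

theorem mfderiv_mfderiv_symm (ψ : M ≃ₘ^∞⟮𝓡 m, 𝓡 m⟯ M) (x : M) (w : TangentSpace (𝓡 m) (ψ x)) :
    mfderiv (𝓡 m) (𝓡 m) ψ x (mfderiv (𝓡 m) (𝓡 m) ψ.symm (ψ x) w) = w := by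
  obtain ⟨v, rfl⟩ := (isInvertible_mfderiv_diffeomorph ψ x).surjective w
  exact congrArg (mfderiv (𝓡 m) (𝓡 m) ψ x) (mfderiv_symm_mfderiv ψ x v)

theorem inverse_mfderiv_symm (ψ : M ≃ₘ^∞⟮𝓡 m, 𝓡 m⟯ M) (x : M) (v : TangentSpace (𝓡 m) x) :
    (mfderiv (𝓡 m) (𝓡 m) ψ.symm (ψ x)).inverse v = mfderiv (𝓡 m) (𝓡 m) ψ x v := by
  have h : (mfderiv (𝓡 m) (𝓡 m) ψ.symm (ψ x)).inverse = mfderiv (𝓡 m) (𝓡 m) ψ x :=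
    ContinuousLinearMap.inverse_eq (ContinuousLinearMap.ext (mfderiv_symm_mfderiv ψ x))
      (ContinuousLinearMap.ext (mfderiv_mfderiv_symm ψ x))
  exact congrArg (fun T : Model m →L[ℝ] Model m => T v) h

theorem mpullback_mpullback_symm (ψ : M ≃ₘ^∞⟮𝓡 m, 𝓡 m⟯ M) (X : ∀ y : M, TangentSpace (𝓡 m) y) :
    VectorField.mpullback (𝓡 m) (𝓡 m) ψ (VectorField.mpullback (𝓡 m) (𝓡 m) ψ.symm X) = X := by
  funext x
  rw [VectorField.mpullback_apply, VectorField.mpullback_apply]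
  have h : ∀ y, y = x → (X y : Model m) = X x := by
    rintro _ rfl; rfl
  refine (congrArg (mfderiv (𝓡 m) (𝓡 m) ψ x).inverse
    (inverse_mfderiv_symm ψ x (X (ψ.symm (ψ x)) : Model m))).trans ?_
  exact ((isInvertible_mfderiv_diffeomorph ψ x).inverse_apply_self _).trans
    (h _ (ψ.symm_apply_apply x))

theorem mfderiv_pullbackEnd (ψ : M ≃ₘ^∞⟮𝓡 m, 𝓡 m⟯ M) (J : EndField m M) (x : M)
    (v : TangentSpace (𝓡 m) x) : mfderiv (𝓡 m) (𝓡 m) ψ x (pullbackEnd ψ J x v) =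
      J (ψ x) (mfderiv (𝓡 m) (𝓡 m) ψ x v) :=
  (isInvertible_mfderiv_diffeomorph ψ x).self_apply_inverse _

theorem pullbackEnd_mpullback (ψ : M ≃ₘ^∞⟮𝓡 m, 𝓡 m⟯ M) (J : EndField m M)
    (X : ∀ y : M, TangentSpace (𝓡 m) y) :
    (fun y => pullbackEnd ψ J y (VectorField.mpullback (𝓡 m) (𝓡 m) ψ X y)) =
      VectorField.mpullback (𝓡 m) (𝓡 m) ψ fun y => J y (X y) := by
  funext x
  refine (isInvertible_mfderiv_diffeomorph ψ x).injective ?_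
  rw [mfderiv_pullbackEnd, VectorField.mpullback_apply, VectorField.mpullback_apply,
    (isInvertible_mfderiv_diffeomorph ψ x).self_apply_inverse,
    (isInvertible_mfderiv_diffeomorph ψ x).self_apply_inverse]

variable [IsManifold (𝓡 m) ∞ M]

theorem SmoothFieldAt.mpullback (ψ : M ≃ₘ^∞⟮𝓡 m, 𝓡 m⟯ M) {X : ∀ y : M, TangentSpace (𝓡 m) y}
    {x : M} (hX : SmoothFieldAt X (ψ x)) :
    SmoothFieldAt (VectorField.mpullback (𝓡 m) (𝓡 m) ψ X) x := by
  have : IsManifold (𝓡 m) (∞ + 1) M := by simpa using (inferInstance : IsManifold (𝓡 m) ∞ M)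
  exact ContMDiffAt.mpullback_vectorField_preimage (n := ∞) hX ψ.contMDiff.contMDiffAt
    (isInvertible_mfderiv_diffeomorph ψ x) (by simp)

theorem SmoothFieldAt.mdifferentiableAt {X : ∀ y : M, TangentSpace (𝓡 m) y} {x : M}
    (hX : SmoothFieldAt X x) : MDifferentiableAt (𝓡 m) (𝓡 m).tangent
      (fun y => (⟨y, X y⟩ : TangentBundle (𝓡 m) M)) x :=
  ContMDiffAt.mdifferentiableAt hX (by simp)

theorem IsSmoothEnd.smoothFieldAt {J : EndField m M} (hJ : IsSmoothEnd J)
    {X : ∀ y : M, TangentSpace (𝓡 m) y} {x : M} (hX : SmoothFieldAt X x) :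
    SmoothFieldAt (fun y => J y (X y)) x := by
  have : IsManifold (𝓡 m) 1 M := IsManifold.of_le (n := ∞) (by simp)
  exact ContMDiffAt.clm_bundle_apply (hJ x) hX

/-- The Nijenhuis tensor of `ψ^* J` is the pullback of that of `J`. -/
theorem nijenhuis_pullbackEnd (ψ : M ≃ₘ^∞⟮𝓡 m, 𝓡 m⟯ M) {J : EndField m M} (hJ : IsSmoothEnd J)
    {X Y : ∀ y : M, TangentSpace (𝓡 m) y} {x : M} (hX : SmoothFieldAt X (ψ x))
    (hY : SmoothFieldAt Y (ψ x)) :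
    nijenhuis (pullbackEnd ψ J) (VectorField.mpullback (𝓡 m) (𝓡 m) ψ X)
      (VectorField.mpullback (𝓡 m) (𝓡 m) ψ Y) x =
      (mfderiv (𝓡 m) (𝓡 m) ψ x).inverse (nijenhuis J X Y (ψ x)) := by
  have : IsManifold (𝓡 m) (minSmoothness ℝ 3) M := by
    rw [minSmoothness_of_isRCLikeNormedField]
    exact IsManifold.of_le (n := ∞) ENat.LEInfty.out
  have hb : ∀ {U W : ∀ y : M, TangentSpace (𝓡 m) y}, SmoothFieldAt U (ψ x) →
      SmoothFieldAt W (ψ x) → VectorField.mlieBracket (𝓡 m)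
        (VectorField.mpullback (𝓡 m) (𝓡 m) ψ U) (VectorField.mpullback (𝓡 m) (𝓡 m) ψ W) x =
      (mfderiv (𝓡 m) (𝓡 m) ψ x).inverse (VectorField.mlieBracket (𝓡 m) U W (ψ x)) :=
    fun hU hW => (VectorField.mpullback_mlieBracket hU.mdifferentiableAt hW.mdifferentiableAt
      (ψ.contMDiff.contMDiffAt (x := x)) minSmoothness_two_le).symm
  have hend : ∀ v, pullbackEnd ψ J x ((mfderiv (𝓡 m) (𝓡 m) ψ x).inverse v) =
      (mfderiv (𝓡 m) (𝓡 m) ψ x).inverse (J (ψ x) v) := fun v => by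
    refine (isInvertible_mfderiv_diffeomorph ψ x).injective ?_
    rw [mfderiv_pullbackEnd, (isInvertible_mfderiv_diffeomorph ψ x).self_apply_inverse,
      (isInvertible_mfderiv_diffeomorph ψ x).self_apply_inverse]
  have hJX := hJ.smoothFieldAt hX
  have hJY := hJ.smoothFieldAt hY
  rw [nijenhuis, pullbackEnd_mpullback, pullbackEnd_mpullback, hb hJX hJY, hb hJX hY, hb hX hJY,
    hb hX hY, hend, hend, nijenhuis, map_sub, map_sub, map_sub]

/-- In coordinates `ψ^* J` is `DΦ⁻¹ ∘ J(Φ) ∘ DΦ`, where `Φ` represents `ψ`. -/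
theorem isSmoothEnd_pullbackEnd (ψ : M ≃ₘ^∞⟮𝓡 m, 𝓡 m⟯ M) {J : EndField m M}
    (hJ : IsSmoothEnd J) : IsSmoothEnd (pullbackEnd ψ J) := by
  refine (isSmoothEnd_iff _).2 fun x => ?_
  have hx := mem_extChartAt_source (I := 𝓡 m) x
  have hxt := mem_of_mem_nhds (target_mem_nhds (m := m) x)
  set Φ : Model m → Model m :=
    fun w => extChartAt (𝓡 m) (ψ x) (ψ ((extChartAt (𝓡 m) x).symm w)) with hΦ
  have hsymm : (extChartAt (𝓡 m) x).symm (extChartAt (𝓡 m) x x) = x :=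
    (extChartAt (𝓡 m) x).left_inv hx
  have hev : ∀ᶠ u in 𝓝 (extChartAt (𝓡 m) x x), u ∈ (extChartAt (𝓡 m) x).target ∧
      ψ ((extChartAt (𝓡 m) x).symm u) ∈ (extChartAt (𝓡 m) (ψ x)).source := by
    have hc : ContinuousAt (fun u => ψ ((extChartAt (𝓡 m) x).symm u)) (extChartAt (𝓡 m) x x) :=
      ψ.continuous.continuousAt.comp (contMDiffAt_chartSymm hxt).continuousAt
    refine Filter.Eventually.and (target_mem_nhds x) (hc.eventually ?_)
    simp only [hsymm]
    exact extChartAt_source_mem_nhds (I := 𝓡 m) (ψ x)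
  have hΦs : ContDiffAt ℝ ∞ Φ (extChartAt (𝓡 m) x x) :=
    contDiffAt_mapRep hxt ψ.contMDiff.contMDiffAt hev.self_of_nhds.2
  have hd : ∀ {u}, u ∈ (extChartAt (𝓡 m) x).target →
      ψ ((extChartAt (𝓡 m) x).symm u) ∈ (extChartAt (𝓡 m) (ψ x)).source → ∀ a,
      fderiv ℝ Φ u a = chartCoframe (ψ x) (ψ ((extChartAt (𝓡 m) x).symm u))
        (mfderiv (𝓡 m) (𝓡 m) ψ ((extChartAt (𝓡 m) x).symm u) (chartFrame x u a)) :=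
    fun hu hy a => fderiv_mapRep hu (ψ.mdifferentiable (by simp) _) hy a
  have hi : ∀ {u}, u ∈ (extChartAt (𝓡 m) x).target →
      ψ ((extChartAt (𝓡 m) x).symm u) ∈ (extChartAt (𝓡 m) (ψ x)).source →
      (fderiv ℝ Φ u).IsInvertible := fun {u} hu hy => by
    refine isInvertible_of_injective rfl fun a ha => ?_
    rw [hd hu hy] at ha
    have h1 := chartCoframe_injective hy (ha.trans (map_zero _).symm)
    have h2 := (isInvertible_mfderiv_diffeomorph ψ _).injective (h1.trans (map_zero _).symm)
    rw [← chartCoframe_frame hu a, h2, map_zero]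
  have hΦ' : ContDiffAt ℝ ∞ (fderiv ℝ Φ) (extChartAt (𝓡 m) x x) := hΦs.fderiv_right (by simp)
  have hJs : ContDiffAt ℝ ∞ (fun u => endRep (ψ x) J (Φ u)) (extChartAt (𝓡 m) x x) := by
    refine ContDiffAt.comp (g := endRep (ψ x) J) _ ?_ hΦs
    simp only [hΦ, hsymm]
    exact (isSmoothEnd_iff J).1 hJ (ψ x)
  refine ((contDiffAt_clm_inverse hΦ' (hi hxt hev.self_of_nhds.2)).clm_comp
    (hJs.clm_comp hΦ')).congr_of_eventuallyEq ?_
  filter_upwards [hev] with u hu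
  refine ContinuousLinearMap.ext fun a => (hi hu.1 hu.2).injective ?_
  rw [ContinuousLinearMap.comp_apply, ContinuousLinearMap.comp_apply,
    (hi hu.1 hu.2).self_apply_inverse, hd hu.1 hu.2, hd hu.1 hu.2, endRep_chartCoframe hu.2,
    endRep_apply, chartFrame_coframe hu.1, mfderiv_pullbackEnd]

theorem IsComplexStructure.pullbackEnd {J : EndField m M} (hJ : IsComplexStructure J)
    (ψ : M ≃ₘ^∞⟮𝓡 m, 𝓡 m⟯ M) : IsComplexStructure (pullbackEnd ψ J) where
  smooth := isSmoothEnd_pullbackEnd ψ hJ.smooth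
  sq x v := by
    refine (isInvertible_mfderiv_diffeomorph ψ x).injective ?_
    rw [mfderiv_pullbackEnd, mfderiv_pullbackEnd, hJ.sq, map_neg]
  integrable x X Y hX hY := by
    have hs : ∀ {X : ∀ y : M, TangentSpace (𝓡 m) y}, SmoothFieldAt X x →
        SmoothFieldAt (VectorField.mpullback (𝓡 m) (𝓡 m) ψ.symm X) (ψ x) := fun {X} hX =>
      SmoothFieldAt.mpullback ψ.symm (by rwa [ψ.symm_apply_apply])
    -- every vector field smooth at `x` is the pullback of one smooth at `ψ x`
    have h := nijenhuis_pullbackEnd ψ hJ.smooth (hs hX) (hs hY)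
    rwa [mpullback_mpullback_symm, mpullback_mpullback_symm, hJ.integrable _ _ _ (hs hX) (hs hY),
      map_zero] at h

end Pullback

/-! ### Recovering the metric from the symplectic form and the two complex structures -/

section Construction

theorem cyclicDeriv_neg {V : Type*} [NormedAddCommGroup V] [NormedSpace ℝ V]
    {B C : V → V →L[ℝ] V →L[ℝ] ℝ} {u : V} (hB : DifferentiableAt ℝ B u)
    (hC : DifferentiableAt ℝ C u) (hCB : ∀ v y z, C v y z = -B v y z) (x y z : V) :
    cyclicDeriv C u x y z = -cyclicDeriv B u x y z := by
  have h : ∀ x y z, fderiv ℝ C u x y z = -fderiv ℝ B u x y z := fun x y z => by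
    simp only [fderiv_form_const_apply hC, fderiv_form_const_apply hB, hCB, fderiv_fun_neg]
    rfl
  simp only [cyclicDeriv, h]
  ring

theorem isVonNBounded_of_pos {V : Type*} [NormedAddCommGroup V] [NormedSpace ℝ V]
    [FiniteDimensional ℝ V] {G : V →L[ℝ] V →L[ℝ] ℝ} (hG : ∀ v, v ≠ 0 → 0 < G v v) :
    Bornology.IsVonNBounded ℝ {v | G v v < 1} := by
  rcases subsingleton_or_nontrivial V with hV | hV
  · exact (NormedSpace.isVonNBounded_iff ℝ).2 ((Set.toFinite _).isBounded)
  have hcont : Continuous fun v => G v v := by fun_prop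
  obtain ⟨e, he, hmin⟩ := (isCompact_sphere (0 : V) 1).exists_isMinOn
    (NormedSpace.sphere_nonempty.2 zero_le_one) hcont.continuousOn
  have he1 : ‖e‖ = 1 := by simpa using he
  have hc : 0 < G e e := hG e (norm_ne_zero_iff.1 (by rw [he1]; exact one_ne_zero))
  -- on the unit sphere the form is at least `G e e`, so the sublevel set has bounded norm
  have hle : ∀ v, G e e * ‖v‖ ^ 2 ≤ G v v := fun v => by
    rcases eq_or_ne v 0 with rfl | hv
    · simp
    have hn := norm_pos_iff.2 hv
    have h1 : G e e ≤ G (‖v‖⁻¹ • v) (‖v‖⁻¹ • v) :=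
      hmin (by simp [norm_smul, inv_mul_cancel₀ hn.ne'])
    simp only [map_smul, smul_apply, smul_eq_mul] at h1
    have h2 := mul_le_mul_of_nonneg_right h1 (sq_nonneg ‖v‖)
    have h3 : ‖v‖⁻¹ * (‖v‖⁻¹ * G v v) * ‖v‖ ^ 2 = G v v := by field_simp
    rwa [h3] at h2
  refine (NormedSpace.isVonNBounded_iff ℝ).2 (isBounded_iff_forall_norm_le.2
    ⟨1 + (G e e)⁻¹, fun v hv => ?_⟩)
  have h1 : G e e * ‖v‖ ^ 2 < 1 := (hle v).trans_lt hv
  have h2 : ‖v‖ ^ 2 < (G e e)⁻¹ := by rwa [← one_div, lt_div_iff₀ hc, mul_comm]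
  nlinarith [sq_nonneg (‖v‖ - 1)]

variable {m : ℕ} {M : Type*} [TopologicalSpace M] [ChartedSpace (EuclideanSpace ℝ (Fin m)) M]
  [IsManifold (𝓡 m) ∞ M] {Ω : BilinField m M} {I J : EndField m M}

/-- Let `W = η + η(I ·, I ·)` be twice the `(1, 1)`-part for `I` of `η = Ω(J ·, ·)`. Then
`dW(I ·, I ·, I ·) = -dβ` with `β = η(I ·, ·) + η(·, I ·)`. -/
theorem cyclicDeriv_oneOnePart (hΩ : ∀ x, ContDiffAt ℝ ∞ (bilinRep x Ω) (extChartAt (𝓡 m) x x))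
    (hskew : ∀ x v w, Ω x v w = -Ω x w v)
    (hclosed : ∀ x a b c, cyclicDeriv (bilinRep x Ω) (extChartAt (𝓡 m) x x) a b c = 0)
    (hI : IsComplexStructure I) (hJ : IsComplexStructure J)
    (hΩJ : ∀ x v w, Ω x (J x v) w = Ω x v (J x w))
    {W β : BilinField m M} (hWd : ∀ x, ContDiffAt ℝ ∞ (bilinRep x W) (extChartAt (𝓡 m) x x))
    (hβd : ∀ x, ContDiffAt ℝ ∞ (bilinRep x β) (extChartAt (𝓡 m) x x))
    (hW : ∀ x v w, W x v w = Ω x (J x v) w + Ω x (J x (I x v)) (I x w))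
    (hβ : ∀ x v w, β x v w = Ω x (J x (I x v)) w + Ω x (J x v) (I x w)) (x : M)
    (a b c : Model m) :
    cyclicDeriv (bilinRep x W) (extChartAt (𝓡 m) x x) (endRep x I (extChartAt (𝓡 m) x x) a)
      (endRep x I (extChartAt (𝓡 m) x x) b) (endRep x I (extChartAt (𝓡 m) x x) c) =
      -cyclicDeriv (bilinRep x β) (extChartAt (𝓡 m) x x) a b c := by
  have hT := target_mem_nhds (m := m) x
  have hd := (contDiffAt_bilinRep_comp (hΩ x) (hJ.contDiffAt x)).differentiableAt (by simp)
  have hsw : ∀ x v w, (fun y => Ω y ∘L J y : BilinField m M) x v w =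
      -(fun y => Ω y ∘L J y : BilinField m M) x w v := fun x v w =>
    (hΩJ x v w).trans (hskew x v (J x w))
  refine cyclicDeriv_oneOne (B := bilinRep x fun y => Ω y ∘L J y) hd (hI.differentiableAt x) ?_
    (bilinRep_swap hsw x _) (hI.flatNijenhuis_eq_zero x) ?_ ((hWd x).differentiableAt (by simp))
    ((hβd x).differentiableAt (by simp)) ?_ ?_ a b c
  · filter_upwards [hT] with u hu using endRep_sq hu hI.sq
  · refine cyclicDeriv_twist_eq_zero (B := bilinRep x Ω) (J := endRep x J)
      ((hΩ x).differentiableAt (by simp)) (hJ.differentiableAt x) ?_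
      (.of_forall (bilinRep_swap hskew x)) ?_ (hJ.flatNijenhuis_eq_zero x) (hclosed x) hd ?_
    · filter_upwards [hT] with u hu using endRep_sq hu hJ.sq
    · filter_upwards [hT] with u hu using bilinRep_endRep_symm hu hΩJ
    · filter_upwards [hT] with u hu y z using (bilinRep_endRep hu Ω J y z).symm
  · filter_upwards [hT] with u hu y z
    simp only [bilinRep_apply, endRep_apply, chartFrame_coframe hu, hW,
      ContinuousLinearMap.comp_apply]
  · filter_upwards [hT] with u hu y z
    simp only [bilinRep_apply, endRep_apply, chartFrame_coframe hu, hβ,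
      ContinuousLinearMap.comp_apply]

/-- The Riemannian metric `Ω([I, J] ·, ·)`. -/
def commMetric (hΩ : ∀ x, ContDiffAt ℝ ∞ (bilinRep x Ω) (extChartAt (𝓡 m) x x))
    (hskew : ∀ x v w, Ω x v w = -Ω x w v)
    (hI : IsComplexStructure I) (hJ : IsComplexStructure J)
    (hΩI : ∀ x v w, Ω x (I x v) w = Ω x v (I x w))
    (hΩJ : ∀ x v w, Ω x (J x v) w = Ω x v (J x w))
    (hpos : ∀ x v, v ≠ 0 → 0 < Ω x (commEnd I J x v) v) : Metric m M where
  inner x := Ω x ∘L commEnd I J x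
  symm x v w := by
    simp only [ContinuousLinearMap.comp_apply, commEnd_apply, map_sub, sub_apply, hΩI, hΩJ]
    rw [hskew x v, hskew x v, hΩJ, hΩI, hΩI, hΩJ]
    ring
  pos := hpos
  isVonNBounded x := isVonNBounded_of_pos (V := Model m) (G := Ω x ∘L commEnd I J x) (hpos x)
  contMDiff := (contMDiff_bilin_iff _).2 fun x => contDiffAt_bilinRep_comp (hΩ x)
    (contDiffAt_commEnd (hI.contDiffAt x) (hJ.contDiffAt x))

/-- A symplectic form of type `(2, 0) + (0, 2)` for two complex structures `I` and `J`, for which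
`Ω([I, J] ·, ·)` is positive, is the symplectic form of a unique nondegenerate generalized Kähler
structure `(g, I, J)`. -/
theorem existsUnique_metric (hΩ : ∀ x, ContDiffAt ℝ ∞ (bilinRep x Ω) (extChartAt (𝓡 m) x x))
    (hskew : ∀ x v w, Ω x v w = -Ω x w v)
    (hclosed : ∀ x a b c, cyclicDeriv (bilinRep x Ω) (extChartAt (𝓡 m) x x) a b c = 0)
    (hI : IsComplexStructure I) (hJ : IsComplexStructure J)
    (hΩI : ∀ x v w, Ω x (I x v) w = Ω x v (I x w))
    (hΩJ : ∀ x v w, Ω x (J x v) w = Ω x v (J x w))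
    (hpos : ∀ x v, v ≠ 0 → 0 < Ω x (commEnd I J x v) v) :
    ∃! g : Metric m M, IsNondegGK g I J ∧ Omega g I J = Ω := by
  set g := commMetric hΩ hskew hI hJ hΩI hΩJ hpos with hg
  have hgΩ : ∀ x v w, g.inner x v w = Ω x (commEnd I J x v) w := fun x v w => rfl
  have hgI : IsHermitian g I := ⟨hI.sq, fun x v w => by
    rw [hgΩ, hgΩ, commEnd_left hI.sq, map_neg, neg_apply, hΩI, hI.sq, map_neg, neg_neg]⟩
  have hgJ : IsHermitian g J := ⟨hJ.sq, fun x v w => by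
    rw [hgΩ, hgΩ, commEnd_right I hJ.sq, map_neg, neg_apply, hΩJ, hJ.sq, map_neg, neg_neg]⟩
  -- the common torsion `H = d^c_I ω_I = -d^c_J ω_J` will be `dβ`
  set β : BilinField m M := fun x => Ω x ∘L (I x ∘L J x + J x ∘L I x) with hβ
  have hβ_apply : ∀ x v w, β x v w = Ω x (I x (J x v)) w + Ω x (J x (I x v)) w := fun x v w => by
    simp only [hβ, ContinuousLinearMap.comp_apply, add_apply, map_add]
  have hβ0 : ∀ x v, β x v v = 0 := fun x v => by
    rw [hβ_apply, hΩI, hΩJ, hskew]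
    ring
  have hβd : ∀ x, ContDiffAt ℝ ∞ (bilinRep x β) (extChartAt (𝓡 m) x x) := fun x => by
    have h1 := contDiffAt_bilinRep_comp (contDiffAt_bilinRep_comp (hΩ x) (hI.contDiffAt x))
      (hJ.contDiffAt x)
    have h2 := contDiffAt_bilinRep_comp (contDiffAt_bilinRep_comp (hΩ x) (hJ.contDiffAt x))
      (hI.contDiffAt x)
    refine (h1.add h2).congr_of_eventuallyEq (.of_forall fun u => ?_)
    refine ContinuousLinearMap.ext fun a => ContinuousLinearMap.ext fun b => ?_
    simp only [add_apply, bilinRep_apply, ContinuousLinearMap.comp_apply, hβ_apply]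
  have hgd : ∀ {J : EndField m M}, IsComplexStructure J → ∀ x,
      ContDiffAt ℝ ∞ (bilinRep x fun y => g.inner y ∘L J y) (extChartAt (𝓡 m) x x) :=
    fun hJ x => contDiffAt_bilinRep_comp (g.contDiffAt x) (hJ.contDiffAt x)
  have hdcI : dc I (fundamentalForm g I hgI) = extDer (twoForm β hβ0) := by
    funext x
    refine ContinuousAlternatingMap.ext fun v => ?_
    rw [dc_fundamentalForm_apply hI hgI, extDer_twoForm hβ0 ((hβd x).differentiableAt (by simp)),
      cyclicDeriv_oneOnePart hΩ hskew hclosed hI hJ hΩJ (hgd hI) hβd ?_ ?_, neg_neg]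
    · intro x v w
      simp only [ContinuousLinearMap.comp_apply, hgΩ, commEnd_apply, map_sub, sub_apply, hI.sq,
        map_neg, neg_apply, ← hΩI]
      ring
    · intro x v w
      rw [hβ_apply, ← hΩI, add_comm]
  have hdcJ : dc J (fundamentalForm g J hgJ) = -extDer (twoForm β hβ0) := by
    funext x
    refine ContinuousAlternatingMap.ext fun v => ?_
    -- exchanging `I` and `J` reverses the sign of `[I, J]`, hence of the fundamental form
    have hWd : ∀ x, ContDiffAt ℝ ∞ (bilinRep x fun y => -(g.inner y ∘L J y))
      (extChartAt (𝓡 m) x x) := fun x => (hgd hJ x).neg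
    have h1 := cyclicDeriv_oneOnePart (W := fun y => -(g.inner y ∘L J y)) hΩ hskew hclosed hJ hI hΩI
      hWd hβd ?_ ?_ x (chartCoframe x x (v 0)) (chartCoframe x x (v 1))
      (chartCoframe x x (v 2))
    · have h2 := cyclicDeriv_neg ((hgd hJ x).differentiableAt (by simp))
        ((hWd x).differentiableAt (by simp)) (fun u a b => rfl)
        (endRep x J (extChartAt (𝓡 m) x x) (chartCoframe x x (v 0)))
        (endRep x J (extChartAt (𝓡 m) x x) (chartCoframe x x (v 1)))
        (endRep x J (extChartAt (𝓡 m) x x) (chartCoframe x x (v 2)))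
      refine (dc_fundamentalForm_apply hJ hgJ x v).trans (h2.symm.trans (h1.trans ?_))
      exact congrArg Neg.neg (extDer_twoForm hβ0 ((hβd x).differentiableAt (by simp)) v).symm
    · intro x v w
      simp only [neg_apply, ContinuousLinearMap.comp_apply, hgΩ, commEnd_apply, map_sub, sub_apply,
        hJ.sq, map_neg, ← hΩJ]
      ring
    · intro x v w
      rw [hβ_apply, ← hΩJ]
  have hσ := fun x => inverse_sigma_eq (V := Model m) (G := g.inner x) (Ω := Ω x)
    (P := commEnd I J x) (g.pos x) fun v => rfl
  refine ⟨g, ⟨⟨⟨hI, hJ, hgI, hgJ, ?_, ?_⟩, fun x => (hσ x).2⟩, funext fun x => (hσ x).1⟩, ?_⟩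
  · rw [hdcI, hdcJ, neg_neg]
  · rw [hdcI]
    exact extDer_extDer_twoForm hβ0 hβd
  · rintro g' ⟨hg', hΩ'⟩
    have h : g'.inner = g.inner := by
      funext x
      refine ContinuousLinearMap.ext fun v => ContinuousLinearMap.ext fun w => ?_
      rw [← hg'.Omega_commEnd, hΩ', hgΩ]
    cases g'
    cases hgg : g
    rw [hgg] at h
    simp only at h
    subst h
    rfl

/-- The flow preserves `Ω`, hence `Ω` is of type `(2, 0) + (0, 2)` also for `φ_t^* J`, and the
hypothesis on the `(1, 1)`-part says that `Ω([I, φ_t^* J] ·, ·)` is positive. -/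
theorem IsNondegGK.existsUnique_metric_of_flow {g : Metric m M} (h : IsNondegGK g I J) {S : Set ℝ}
    {f : ℝ → M → ℝ} {φ : ℝ → M ≃ₘ^∞⟮𝓡 m, 𝓡 m⟯ M} (hφ : IsHamiltonianFlow (Omega g I J) S f φ)
    {t : ℝ} (ht : t ∈ S)
    (hpos : ∀ x : M, IsPositive I x (oneOnePart I x fun v w =>
      -(complexForm (Omega g I J) (pullbackEnd (φ t) J) x v w).im)) :
    ∃! g' : Metric m M, IsNondegGK g' I (pullbackEnd (φ t) J) ∧
      Omega g' I (pullbackEnd (φ t) J) = Omega g I J := by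
  have hpres := hφ.pullback_eq h.contDiffAt_Omega h.Omega_skew h.cyclicDeriv_Omega ht
  have htype : ∀ x v w, Omega g I J x (pullbackEnd (φ t) J x v) w =
      Omega g I J x v (pullbackEnd (φ t) J x w) := fun x v w => by
    rw [← hpres, ← hpres x v, mfderiv_pullbackEnd, mfderiv_pullbackEnd, h.Omega_right]
  refine existsUnique_metric h.contDiffAt_Omega h.Omega_skew h.cyclicDeriv_Omega
    h.complex_I (h.complex_J.pullbackEnd (φ t)) h.Omega_left htype fun x v hv => ?_
  have h1 := hpos x v hv
  have him : ∀ a b, -(complexForm (Omega g I J) (pullbackEnd (φ t) J) x a b).im =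
      Omega g I J x (pullbackEnd (φ t) J x a) b := fun a b => by
    simp [complexForm]
  simp only [oneOnePart, him] at h1
  rw [commEnd_apply, map_sub, sub_apply, h.Omega_left]
  rw [h.complex_I.sq, map_neg] at h1
  linarith

end Construction

end GenKahler

end

theorem mainTheorem8 (n : ℕ) {M : Type*} [TopologicalSpace M] [T2Space M]
    [SecondCountableTopology M] [ChartedSpace (EuclideanSpace ℝ (Fin (4 * n))) M]
    [IsManifold (𝓡 (4 * n)) ∞ M]
    (g : GenKahler.Metric (4 * n) M) (I J : GenKahler.EndField (4 * n) M)
    (hgk : GenKahler.IsNondegGK g I J)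
    (S : Set ℝ) (f : ℝ → M → ℝ) (φ : ℝ → M ≃ₘ^∞⟮𝓡 (4 * n), 𝓡 (4 * n)⟯ M)
    (hφ : GenKahler.IsHamiltonianFlow (GenKahler.Omega g I J) S f φ) :
    ∀ t ∈ S,
      (∀ x : M, GenKahler.IsPositive I x (GenKahler.oneOnePart I x fun v w =>
        -(GenKahler.complexForm (GenKahler.Omega g I J)
          (GenKahler.pullbackEnd (φ t) J) x v w).im)) →
      ∃! g' : GenKahler.Metric (4 * n) M,
        GenKahler.IsNondegGK g' I (GenKahler.pullbackEnd (φ t) J) ∧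
          GenKahler.Omega g' I (GenKahler.pullbackEnd (φ t) J) = GenKahler.Omega g I J :=
  fun _ ht hpos => hgk.existsUnique_metric_of_flow hφ ht hpos
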